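/- All languages are over $\Sigma=\{0,1\}$. A polynomial-time oracle Turing machine (DPOM if deterministic, NPOM if nondeterministic) is one for which some polynomial $p$ bounds the length of every computation path on every input $x$ by $p(|x|)$, for every oracle; $L(N^A)$ is the language accepted by $N$ with oracle $A$, and a machine without oracle is a machine with oracle $\emptyset$. For a language $A$, $\mathrm{P}^A$ is the class of languages $L(M^A)$ with $M$ a DPOM, and $\mathrm{UP}^A$ is the class of languages $L(N^A)$ with $N$ an NPOM such that $N^A$ has at most one accepting path on every input. Put $\mathrm{P}=\mathrm{P}^\emptyset$, $\mathrm{UP}=\mathrm{UP}^\emptyset$, and $\mathrm{UP}^{\mathcal C}=\bigcup_{A\in\mathcal C}\mathrm{UP}^A$ for a class $\mathcal C$. A set $S$ is sparse if for some polynomial $q$ and all $m\ge 0$ it has at most $q(m)$ strings of length at most $m$; it is Turing-complete for $\mathcal C$ if $S\in\mathcal C$ and $A\in\mathrm{P}^S$ for all $A\in\mathcal C$. The unambiguous polynomial hierarchy is $\mathrm{U}\Sigma_0^p=\mathrm{P}$, $\mathrm{U}\Sigma_k^p=\mathrm{UP}^{\mathrm{U}\Sigma_{k-1}^p}$ for $k\ge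 1$. The promise unambiguous polynomial hierarchy is $\mathcal{U}\Sigma_0^p=\mathrm{P}$, $\mathcal{U}\Sigma_1^p=\mathrm{UP}$, and, for $k\ge 2$, $L\in\mathcal{U}\Sigma_k^p$ if and only if there are NPOMs $N_1,\dots,N_k$ such that, with $L_{k+1}=\emptyset$ and $L_i=L(N_i^{L_{i+1}})$ for $1\le i\le k$, one has $L=L_1$ and, for every input $x$: $N_1^{L_2}$ has at most one accepting path on $x$; and for every $1\le i\le k-1$, if $N_i$ asks some query $q$ in the course of the computation of $N_1(x)$ (that is, on some path of a computation of $N_i^{L_{i+1}}$ on $x$ if $i=1$, or on a string that $N_{i-1}$ asks in the course of the computation of $N_1(x)$ if $i\ge 2$), then $N_{i+1}^{L_{i+2}}$ has at most one accepting path on $q$. $\mathrm{P}^{\mathcal{UP}}$ is the class of languages $L(M^{L(N^{\emptyset})})$ with $M$ a DPOM and $N$ an NPOM such that on no input does $M$, with oracle $L(N^{\emptyset})$, ask a query on which $N^{\emptyset}$ has more than one accepting path (guardedly unambiguous access to an NP oracle). **Theorem.** If there exists a sparse Turing-complete set for $\mathrm{UP}$, then 1. $\mathrm{UP}^{\mathrm{UP}}\subseteq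 \mathrm{P}^{\mathcal{UP}}$, and 2. $\mathrm{U}\Sigma_k^p\subseteq \mathcal{U}\Sigma_{k-1}^p$ for every $k\ge 3$. -/

import Mathlib

namespace Cplx

/-- Strings over the alphabet `{0, 1}`. -/
abbrev Word : Type := List Bool

/-- Languages over the alphabet `{0, 1}`. -/
abbrev Lang : Type := Set Word

/-- The instructions of a nondeterministic multi-tape oracle Turing machine with finite set of
control states `Λ`. The storage is presented, as in Mathlib's machine model `Turing.TM2`, by
finitely many stacks (indexed by `K`); a Turing tape with its head is a pair of stacks.
Each instruction is one step. -/
inductive Instr (K Λ : Type) : Type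
  /-- push the symbol `b` on stack `k` and go to state `next` -/
  | push (k : K) (b : Bool) (next : Λ) : Instr K Λ
  /-- remove the top symbol of stack `k` and go to a state depending on that symbol
  (on `none`, if the stack is empty) -/
  | pop (k : K) (next : Option Bool → Λ) : Instr K Λ
  /-- nondeterministic binary branching -/
  | guess (next : Bool → Λ) : Instr K Λ
  /-- ask the oracle about the string on the query stack, erase that stack, and go to a state
  depending on the answer -/
  | query (next : Bool → Λ) : Instr K Λ
  /-- halt and accept -/
  | accept : Instr K Λ
  /-- halt and reject -/
  | reject : Instr K Λ

/-- A nondeterministic oracle Turing machine. -/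
structure OracleTM where
  /-- the index set of the stacks -/
  K : Type
  /-- the set of control states -/
  Λ : Type
  [decK : DecidableEq K]
  [finK : Finite K]
  [finΛ : Finite Λ]
  /-- the stack that holds the input at the start, its first symbol on top -/
  input : K
  /-- the stack on which queries are written, their first symbol on top -/
  queryStack : K
  /-- the initial state -/
  start : Λ
  /-- the program -/
  instr : Λ → Instr K Λ

attribute [instance] OracleTM.decK OracleTM.finK OracleTM.finΛ

namespace OracleTM

/-- A configuration: the control state and the contents of the stacks (top first). -/
@[ext]
structure Cfg (M : OracleTM) where
  state : M.Λ
  stk : M.K → Word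

/-- The initial configuration on input `x`. -/
def init (M : OracleTM) (x : Word) : M.Cfg where
  state := M.start
  stk := Function.update (fun _ => []) M.input x

open Classical in
/-- The successor of a configuration whose instruction is neither a nondeterministic branching
nor a halting instruction, when the oracle is `A`. -/
noncomputable def detStep (M : OracleTM) (A : Lang) (c : M.Cfg) : Option M.Cfg :=
  match M.instr c.state with
  | .push k b next => some ⟨next, Function.update c.stk k (b :: c.stk k)⟩
  | .pop k next => some ⟨next (c.stk k).head?, Function.update c.stk k (c.stk k).tail⟩
  | .query next =>
      some ⟨next (decide (c.stk M.queryStack ∈ A)), Function.update c.stk M.queryStack []⟩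
  | .guess _ => none
  | .accept => none
  | .reject => none

/-- `M.Computes A c g n d`: with oracle `A`, the machine gets from `c` to `d` in exactly `n` steps,
and the list of its nondeterministic choices on the way is `g`. -/
inductive Computes (M : OracleTM) (A : Lang) : M.Cfg → List Bool → ℕ → M.Cfg → Prop
  | refl (c : M.Cfg) : Computes M A c [] 0 c
  | det {c c' d : M.Cfg} {g : List Bool} {n : ℕ} (hstep : M.detStep A c = some c')
      (h : Computes M A c' g n d) : Computes M A c g (n + 1) d
  | guess {c d : M.Cfg} {g : List Bool} {n : ℕ} {next : Bool → M.Λ} (b : Bool)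
      (hinstr : M.instr c.state = Instr.guess next)
      (h : Computes M A ⟨next b, c.stk⟩ g n d) : Computes M A c (b :: g) (n + 1) d

/-- `g` is (the list of nondeterministic choices of) an accepting computation path of `M` with
oracle `A` on input `x`. -/
def AcceptingPath (M : OracleTM) (A : Lang) (x : Word) (g : List Bool) : Prop :=
  ∃ (n : ℕ) (d : M.Cfg), M.Computes A (M.init x) g n d ∧ M.instr d.state = Instr.accept

/-- The language `L(M^A)`. -/
def lang (M : OracleTM) (A : Lang) : Lang :=
  {x | ∃ g, M.AcceptingPath A x g}

/-- `M^A` has at most one accepting path on input `x`. -/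
def UnambiguousAt (M : OracleTM) (A : Lang) (x : Word) : Prop :=
  ∀ g g', M.AcceptingPath A x g → M.AcceptingPath A x g' → g = g'

/-- The strings about which `M^A` asks its oracle on some computation path on input `x`. -/
def queries (M : OracleTM) (A : Lang) (x : Word) : Set Word :=
  {q | ∃ (g : List Bool) (n : ℕ) (d : M.Cfg) (next : Bool → M.Λ),
    M.Computes A (M.init x) g n d ∧ M.instr d.state = Instr.query next ∧ d.stk M.queryStack = q}

/-- `M` runs in polynomial time: for some polynomial `p`, and whatever the oracle, all computation
paths on all inputs `x` have at most `p(|x|)` steps (in particular all of them halt). -/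
def PolyTime (M : OracleTM) : Prop :=
  ∃ p : Polynomial ℕ, ∀ (A : Lang) (x : Word) (g : List Bool) (n : ℕ) (d : M.Cfg),
    M.Computes A (M.init x) g n d → n ≤ p.eval x.length

/-- `M` never branches nondeterministically. -/
def Deterministic (M : OracleTM) : Prop :=
  ∀ (l : M.Λ) (next : Bool → M.Λ), M.instr l ≠ Instr.guess next

end OracleTM

/-- `P^A`, the class of languages that are polynomial-time Turing reducible to `A`. -/
def PRel (A : Lang) : Set Lang :=
  {L | ∃ M : OracleTM, M.PolyTime ∧ M.Deterministic ∧ L = M.lang A}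

/-- `UP^A`: the machine has to be unambiguous, with oracle `A`, on every input. -/
def UPRel (A : Lang) : Set Lang :=
  {L | ∃ M : OracleTM, M.PolyTime ∧ (∀ x, M.UnambiguousAt A x) ∧ L = M.lang A}

/-- The class `P` (machines without oracle are machines with the empty oracle). -/
def P : Set Lang := PRel ∅

/-- The class `UP`. -/
def UP : Set Lang := UPRel ∅

/-- `UP^C` for a class `C` of languages. -/
def UPRelClass (C : Set Lang) : Set Lang :=
  {L | ∃ A ∈ C, L ∈ UPRel A}

/-- The levels `UΣ_k^p` of the unambiguous polynomial hierarchy. -/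
def USigma : ℕ → Set Lang
  | 0 => P
  | k + 1 => UPRelClass (USigma k)

/-- For machines `N₁, …, N_k`, the language of `N₁` with oracle the language of `N₂` with oracle
… the language of `N_k`. -/
def towerLang : List OracleTM → Lang
  | [] => ∅
  | N :: Ns => N.lang (towerLang Ns)

/-- For machines `N₁, …, N_k`, each having the tower of its successors as its oracle: all the
computations that are executed in the computation of `N₁` on `x` are unambiguous, that is,
`N₁` has at most one accepting path on `x`, and whenever some `N_i` is asked a query in the
course of this computation, then `N_i` has at most one accepting path on that query. -/
def GuardedlyUnambiguous : List OracleTM → Word → Prop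
  | [], _ => True
  | N :: Ns, x =>
      N.UnambiguousAt (towerLang Ns) x ∧
        ∀ q ∈ N.queries (towerLang Ns) x, GuardedlyUnambiguous Ns q

/-- The levels `𝒰Σ_k^p` of the promise unambiguous polynomial hierarchy. -/
def PromiseUSigma : ℕ → Set Lang
  | 0 => P
  | 1 => UP
  | k + 2 => {L | ∃ Ns : List OracleTM, Ns.length = k + 2 ∧ (∀ N ∈ Ns, N.PolyTime) ∧
      L = towerLang Ns ∧ ∀ x, GuardedlyUnambiguous Ns x}

/-- `P^𝒰P`: the languages accepted by a deterministic polynomial-time oracle machine `M`, with the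
language of a nondeterministic polynomial-time machine `N` as its oracle, such that on no input
does `M` ask a query on which `N` has more than one accepting path. -/
def PPromiseUP : Set Lang :=
  {L | ∃ M N : OracleTM, M.PolyTime ∧ M.Deterministic ∧ N.PolyTime ∧ L = M.lang (N.lang ∅) ∧
    ∀ x, ∀ q ∈ M.queries (N.lang ∅) x, N.UnambiguousAt ∅ q}

/-- `S` is sparse: the number of its strings of length at most `m` is polynomially bounded
in `m`. -/
def IsSparse (S : Lang) : Prop :=
  ∃ q : Polynomial ℕ, ∀ m : ℕ, {w | w ∈ S ∧ w.length ≤ m}.ncard ≤ q.eval m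

/-- `S` is Turing-complete for the class `C`. -/
def IsTuringComplete (S : Lang) (C : Set Lang) : Prop :=
  S ∈ C ∧ ∀ A ∈ C, A ∈ PRel S

end Cplx

/-! Let `S` be sparse and complete for UP, `V` an unambiguous machine for `S`, and `N` a machine
that is unambiguous with oracle `S`. Composing with a deterministic reduction turns UP^UP into UP^S,
so it suffices to decide L(N^S) with guarded access to an NP oracle.

On input x let m bound the length of the queries of `N`, and let k₀ be the number of words of `S` of
length at most m; sparseness bounds k₀ by a polynomial r. The NP machine `census` receives a flag
and k, m, x. It guesses k words of length at most m in increasing order, verifies each with `V`,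
and, if the flag is set, runs `N` on x with the guessed list as oracle. For k > k₀ there is no
accepting path (`not_acceptingPath_censusCode_of_lt`). For k = k₀ the list must consist of all words
of `S` up to length m; since `V` is unambiguous, it is reached on one path only, and `N` then
behaves as with oracle `S`, so at most one path accepts (`unambiguousAt_censusCode`). Ambiguity can
arise only for k < k₀. A deterministic machine therefore counts k down from r with the flag off: the
first yes comes at k₀ (`searchVal_eq`), and then one question with the flag on decides x
(`censusCode_true_mem_iff`). No k < k₀ is ever asked.

For the hierarchy, UP^P = UP by composition, so the third level is contained in UP over P^𝒰P. The
upper machine absorbs the deterministic one, which leaves a guarded tower of two machines; each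
further level puts one machine on top.

To make the machines concrete, flow graphs (`Frag`) are composed by `bind` and `iter`. Their
semantics `Sem` records a time bound, a guard on the queries, and the whole tree of choices:
counting accepting paths needs the tree and not only the accepted language. -/

namespace Cplx

/-! ### Trees of nondeterministic choices -/

/-- Finite binary trees of nondeterministic choices. -/
inductive Tr (α : Type) : Type
  | ret (a : α) : Tr α
  | fail : Tr α
  | node (l r : Tr α) : Tr α

namespace Tr

variable {α β γ : Type}

def bind : Tr α → (α → Tr β) → Tr β
  | ret a, f => f a
  | fail, _ => fail
  | node l r, f => node (l.bind f) (r.bind f)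

def map (f : α → β) (t : Tr α) : Tr β := t.bind fun a => ret (f a)

/-- The choices `g` lead to the leaf `a`. -/
def Path : Tr α → List Bool → α → Prop
  | ret a, g, b => g = [] ∧ b = a
  | fail, _, _ => False
  | node _ _, [], _ => False
  | node l _, false :: g, a => l.Path g a
  | node _ r, true :: g, a => r.Path g a

@[simp] lemma bind_ret (a : α) (f : α → Tr β) : (ret a).bind f = f a := rfl
@[simp] lemma bind_fail (f : α → Tr β) : (fail : Tr α).bind f = fail := rfl
@[simp] lemma bind_node (l r : Tr α) (f : α → Tr β) :
    (node l r).bind f = node (l.bind f) (r.bind f) := rfl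
@[simp] lemma map_ret (a : α) (f : α → β) : (ret a).map f = ret (f a) := rfl
@[simp] lemma map_fail (f : α → β) : (fail : Tr α).map f = fail := rfl
@[simp] lemma map_node (l r : Tr α) (f : α → β) :
    (node l r).map f = node (l.map f) (r.map f) := rfl

@[simp] lemma path_ret {a b : α} {g : List Bool} : (ret a).Path g b ↔ g = [] ∧ b = a := Iff.rfl
@[simp] lemma path_fail {b : α} {g : List Bool} : (fail : Tr α).Path g b ↔ False := Iff.rfl
@[simp] lemma path_node_nil {l r : Tr α} {b : α} : (node l r).Path [] b ↔ False := by
  simp [Path]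
@[simp] lemma path_node_cons {l r : Tr α} {b : α} {c : Bool} {g : List Bool} :
    (node l r).Path (c :: g) b ↔ (if c then r else l).Path g b := by
  cases c <;> simp [Path]

@[simp] lemma bind_pure (t : Tr α) : t.bind ret = t := by
  induction t <;> simp_all

@[simp] lemma map_id (t : Tr α) : t.map (fun a => a) = t := bind_pure t

lemma bind_assoc (t : Tr α) (f : α → Tr β) (h : β → Tr γ) :
    (t.bind f).bind h = t.bind fun a => (f a).bind h := by
  induction t <;> simp_all

lemma bind_map (t : Tr α) (f : α → β) (h : β → Tr γ) :
    (t.map f).bind h = t.bind fun a => h (f a) := bind_assoc _ _ _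

lemma map_bind (t : Tr α) (f : α → Tr β) (h : β → γ) :
    (t.bind f).map h = t.bind fun a => (f a).map h := bind_assoc _ _ _

lemma path_bind {t : Tr α} {f : α → Tr β} {g : List Bool} {b : β} :
    (t.bind f).Path g b ↔ ∃ g₁ g₂ a, g = g₁ ++ g₂ ∧ t.Path g₁ a ∧ (f a).Path g₂ b := by
  induction t generalizing g with
  | ret a => simp
  | fail => simp
  | node l r ihl ihr =>
    constructor
    · rcases g with _ | ⟨c, g⟩
      · simp
      · intro h
        simp only [bind_node, path_node_cons] at h
        have : ∃ g₁ g₂ a, g = g₁ ++ g₂ ∧ (if c then r else l).Path g₁ a ∧ (f a).Path g₂ b := by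
          cases c
          · exact ihl.1 h
          · exact ihr.1 h
        obtain ⟨g₁, g₂, a, rfl, h₁, h₂⟩ := this
        exact ⟨c :: g₁, g₂, a, rfl, by simpa using h₁, h₂⟩
    · rintro ⟨_ | ⟨c, g₁⟩, g₂, a, rfl, h₁, h₂⟩
      · simp at h₁
      · cases c
        · simpa using ihl.2 ⟨g₁, g₂, a, rfl, by simpa using h₁, h₂⟩
        · simpa using ihr.2 ⟨g₁, g₂, a, rfl, by simpa using h₁, h₂⟩

lemma path_map {t : Tr α} {f : α → β} {g : List Bool} {b : β} :
    (t.map f).Path g b ↔ ∃ a, t.Path g a ∧ b = f a := by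
  rw [map, path_bind]
  constructor
  · rintro ⟨g₁, g₂, a, rfl, h₁, rfl, rfl⟩
    exact ⟨a, by simpa using h₁, rfl⟩
  · rintro ⟨a, h₁, rfl⟩
    exact ⟨g, [], a, by simp, h₁, rfl, rfl⟩

/-- Different paths lead to different leaves. -/
def Inj (t : Tr α) : Prop := ∀ g g' a, t.Path g a → t.Path g' a → g = g'

lemma Inj.bind {t : Tr α} {f : α → Tr β} (ht : t.Inj) (hf : ∀ a, (f a).Inj)
    (hd : ∀ a a' g g' b, (f a).Path g b → (f a').Path g' b → a = a') : (t.bind f).Inj := by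
  intro g g' b h h'
  obtain ⟨g₁, g₂, a, rfl, h₁, h₂⟩ := path_bind.1 h
  obtain ⟨g₁', g₂', a', rfl, h₁', h₂'⟩ := path_bind.1 h'
  obtain rfl := hd _ _ _ _ _ h₂ h₂'
  rw [ht _ _ _ h₁ h₁', hf _ _ _ _ h₂ h₂']

end Tr

/-! ### Flow graphs and their big-step semantics -/

namespace Instr

variable {K Λ Λ' : Type}

def map (f : Λ → Λ') : Instr K Λ → Instr K Λ'
  | push k b nx => push k b (f nx)
  | pop k nx => pop k fun o => f (nx o)
  | guess nx => guess fun b => f (nx b)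
  | query nx => query fun b => f (nx b)
  | accept => accept
  | reject => reject

end Instr

/-- The contents of the stacks. -/
abbrev Store (K : Type) : Type := K → Word

/-- The circumstances of a run: the query stack, the oracle, and the queries that are permitted. -/
structure Env (K : Type) where
  qs : K
  oracle : Lang
  permitted : Set Word

open Function (update extend)

section Ev

variable {K α β Λ Λ' : Type} [DecidableEq K]

open Classical in
/-- In a flow graph with nodes `Λ` and exits `α`, every path from the given point and store halts
within `T` steps, and `t` is the tree of the choices and the outcomes. -/
inductive Ev (E : Env K) (ins : Λ → Instr K (Λ ⊕ α)) :
    Λ ⊕ α → Store K → ℕ → Tr (α × Store K) → Prop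
  | exit (a : α) (s : Store K) (T : ℕ) : Ev E ins (.inr a) s T (.ret (a, s))
  | push {l k b nx s T t} (hi : ins l = .push k b nx)
      (h : Ev E ins nx (update s k (b :: s k)) T t) : Ev E ins (.inl l) s (T + 1) t
  | pop {l k nx s T t} (hi : ins l = .pop k nx)
      (h : Ev E ins (nx (s k).head?) (update s k (s k).tail) T t) : Ev E ins (.inl l) s (T + 1) t
  | guess {l nx s T t₀ t₁} (hi : ins l = .guess nx)
      (h₀ : Ev E ins (nx false) s T t₀) (h₁ : Ev E ins (nx true) s T t₁) :
      Ev E ins (.inl l) s (T + 1) (.node t₀ t₁)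
  | query {l nx s T t} (hi : ins l = .query nx) (hq : s E.qs ∈ E.permitted)
      (h : Ev E ins (nx (decide (s E.qs ∈ E.oracle))) (update s E.qs []) T t) :
      Ev E ins (.inl l) s (T + 1) t
  | reject {l s T} (hi : ins l = .reject) : Ev E ins (.inl l) s T .fail

lemma Ev.mono {E : Env K} {ins : Λ → Instr K (Λ ⊕ α)} {c s T T' t} (h : Ev E ins c s T t)
    (hT : T ≤ T') : Ev E ins c s T' t := by
  induction h generalizing T' with
  | exit a s T => exact .exit a s T'
  | reject hi => exact .reject hi
  | push hi _ ih =>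
    obtain ⟨T', rfl⟩ := Nat.exists_eq_add_of_le' (Nat.le_of_add_left_le hT)
    exact .push hi (ih (by omega))
  | pop hi _ ih =>
    obtain ⟨T', rfl⟩ := Nat.exists_eq_add_of_le' (Nat.le_of_add_left_le hT)
    exact .pop hi (ih (by omega))
  | guess hi _ _ ih ih' =>
    obtain ⟨T', rfl⟩ := Nat.exists_eq_add_of_le' (Nat.le_of_add_left_le hT)
    exact .guess hi (ih (by omega)) (ih' (by omega))
  | query hi hq _ ih =>
    obtain ⟨T', rfl⟩ := Nat.exists_eq_add_of_le' (Nat.le_of_add_left_le hT)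
    exact .query hi hq (ih (by omega))

/-- Continue a run in another flow graph, where `φ` labels the outcomes. -/
lemma Ev.trans {γ : Type} {E : Env K} {ins : Λ → Instr K (Λ ⊕ α)}
    {ins' : Λ' → Instr K (Λ' ⊕ β)} {j : Λ ⊕ α → Λ' ⊕ β} {φ : Λ → Λ'}
    (hj : ∀ l, j (.inl l) = .inl (φ l)) (hins : ∀ l, ins' (φ l) = (ins l).map j)
    {c s T t'} (h : Ev E ins c s T t') {T' : ℕ} {t : Tr γ} {v : γ → α × Store K}
    (ht : t' = t.map v) {f : γ → Tr (β × Store K)}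
    (hf : ∀ g x, t.Path g x → Ev E ins' (j (.inr (v x).1)) (v x).2 T' (f x)) :
    Ev E ins' (j c) s (T + T') (t.bind f) := by
  induction h generalizing t with
  | exit a s T =>
    cases t with
    | ret x =>
      simp only [Tr.map_ret, Tr.ret.injEq] at ht
      have := hf [] x (by simp)
      rw [← ht] at this
      exact this.mono (by omega)
    | _ => simp at ht
  | @reject l s T hi =>
    cases t with
    | fail =>
      rw [hj]
      exact .reject (by rw [hins, hi]; rfl)
    | _ => simp at ht
  | push hi _ ih =>
    rw [hj, Nat.add_right_comm]
    exact .push (by rw [hins, hi]; rfl) (ih ht hf)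
  | pop hi _ ih =>
    rw [hj, Nat.add_right_comm]
    exact .pop (nx := fun o => j (_)) (by rw [hins, hi]; rfl) (ih ht hf)
  | guess hi _ _ ih₀ ih₁ =>
    cases t with
    | node l r =>
      simp only [Tr.map_node, Tr.node.injEq] at ht
      rw [hj, Nat.add_right_comm]
      exact .guess (nx := fun o => j (_)) (by rw [hins, hi]; rfl)
        (ih₀ ht.1 fun g x hp => hf (false :: g) x (by simpa using hp))
        (ih₁ ht.2 fun g x hp => hf (true :: g) x (by simpa using hp))
    | _ => simp at ht
  | query hi hq _ ih =>
    rw [hj, Nat.add_right_comm]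
    exact .query (nx := fun o => j (_)) (by rw [hins, hi]; rfl) hq (ih ht hf)

end Ev

/-- A flow graph whose exits are labelled by `α`. -/
structure Frag (K α : Type) : Type 1 where
  Λ : Type
  [finΛ : Finite Λ]
  start : Λ
  instr : Λ → Instr K (Λ ⊕ α)

attribute [instance] Frag.finΛ

namespace Frag

variable {K α β σ : Type}

def one (i : Instr K α) : Frag K α where
  Λ := Unit
  start := ()
  instr _ := i.map .inr

def push (k : K) (b : Bool) (a : α) : Frag K α := one (.push k b a)
def pop (k : K) (f : Option Bool → α) : Frag K α := one (.pop k f)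
def guess (f : Bool → α) : Frag K α := one (.guess f)
def query (f : Bool → α) : Frag K α := one (.query f)
def reject : Frag K α := one .reject

def map (f : α → β) (F : Frag K α) : Frag K β where
  Λ := F.Λ
  start := F.start
  instr l := (F.instr l).map (Sum.map id f)

/-- One copy of `G a` is added for every exit `a`; finiteness of `α` keeps the control finite. -/
def bind [Finite α] (F : Frag K α) (G : α → Frag K β) : Frag K β where
  Λ := F.Λ ⊕ Σ a, (G a).Λ
  start := .inl F.start
  instr
    | .inl l => (F.instr l).map (Sum.elim (fun l' => .inl (.inl l'))
        fun a => .inl (.inr ⟨a, (G a).start⟩))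
    | .inr l => ((G l.1).instr l.2).map (Sum.map (fun l' => .inr ⟨l.1, l'⟩) id)

/-- The program does not depend on where the loop is entered, so `iter F x` and `iter F y` differ
only in the start. This is why the rest of a loop can be treated as another run of `iter`. -/
def iterInstr (F : σ → Frag K (σ ⊕ α)) (l : Σ x, (F x).Λ) : Instr K ((Σ x, (F x).Λ) ⊕ α) :=
  ((F l.1).instr l.2).map (Sum.elim (fun l' => .inl ⟨l.1, l'⟩)
    (Sum.elim (fun x => .inl ⟨x, (F x).start⟩) .inr))

def iter [Finite σ] (F : σ → Frag K (σ ⊕ α)) (x : σ) : Frag K α where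
  Λ := Σ x, (F x).Λ
  start := ⟨x, (F x).start⟩
  instr := iterInstr F

variable [DecidableEq K]

/-- Every run of the fragment from the given store halts within `T` steps, and `t` is the tree of
the choices and the outcomes. -/
def Sem (E : Env K) (F : Frag K α) (s : Store K) (T : ℕ) (t : Tr (α × Store K)) : Prop :=
  Ev E F.instr (.inl F.start) s T t

variable {E : Env K} {s : Store K} {T T' : ℕ}

lemma Sem.mono {F : Frag K α} {t} (h : Sem E F s T t) (hT : T ≤ T') : Sem E F s T' t :=
  Ev.mono h hT

lemma Sem.congr {F : Frag K α} {t t'} (h : Sem E F s T t) (hT : T ≤ T') (ht : t = t') :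
    Sem E F s T' t' := ht ▸ h.mono hT

/-- Do nothing. -/
def pure (k : K) (a : α) : Frag K α := (push k true ()).bind fun _ => pop k fun _ => a

lemma sem_push (k : K) (b : Bool) (a : α) :
    Sem E (push k b a) s 1 (.ret (a, update s k (b :: s k))) :=
  Ev.push (nx := .inr a) rfl (Ev.exit ..)

lemma sem_pop (k : K) (f : Option Bool → α) :
    Sem E (pop k f) s 1 (.ret (f (s k).head?, update s k (s k).tail)) :=
  Ev.pop (nx := fun o => .inr (f o)) rfl (Ev.exit ..)

lemma sem_guess (f : Bool → α) :
    Sem E (guess f) s 1 (.node (.ret (f false, s)) (.ret (f true, s))) :=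
  Ev.guess (nx := fun o => .inr (f o)) rfl (Ev.exit ..) (Ev.exit ..)

open Classical in
lemma sem_query (f : Bool → α) (h : s E.qs ∈ E.permitted) :
    Sem E (query f) s 1 (.ret (f (decide (s E.qs ∈ E.oracle)), update s E.qs [])) :=
  Ev.query (nx := fun o => .inr (f o)) rfl h (Ev.exit ..)

lemma sem_reject : Sem E (reject : Frag K α) s 0 .fail := Ev.reject rfl

lemma Sem.map {F : Frag K α} {t} (h : Sem E F s T t) (f : α → β) :
    Sem E (F.map f) s T (t.map fun p => (f p.1, p.2)) :=
  Ev.trans (j := Sum.map id f) (φ := id) (T' := 0) (ins' := (F.map f).instr) (fun _ => rfl)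
    (fun _ => rfl) h (Tr.map_id t).symm fun _ _ _ => Ev.exit ..

/-- The outcomes are indexed through `v` by a smaller datum, such as a guessed word or list. The
continuation is then a function of this datum, and has to be analysed only at leaves that occur. -/
lemma Sem.bind_map {γ : Type} [Finite α] {F : Frag K α} {G : α → Frag K β} {t : Tr γ}
    {v : γ → α × Store K} (h : Sem E F s T (t.map v)) {f : γ → Tr (β × Store K)}
    (hf : ∀ g x, t.Path g x → Sem E (G (v x).1) (v x).2 T' (f x)) :
    Sem E (F.bind G) s (T + T') (t.bind f) := by
  refine Ev.trans (j := Sum.elim (fun l' => .inl (.inl l')) fun a => .inl (.inr ⟨a, (G a).start⟩))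
    (φ := .inl) (ins' := (F.bind G).instr) (fun _ => rfl) (fun _ => rfl) h rfl fun g x hp => ?_
  have := Ev.trans (j := Sum.map (fun l' => .inr ⟨(v x).1, l'⟩) id)
    (φ := fun l' => .inr ⟨(v x).1, l'⟩)
    (T' := 0) (ins' := (F.bind G).instr) (fun _ => rfl) (fun _ => rfl) (hf g x hp)
    (Tr.map_id _).symm (f := .ret) fun _ _ _ => Ev.exit ..
  rw [Tr.bind_pure] at this
  exact this

lemma Sem.bind [Finite α] {F : Frag K α} {G : α → Frag K β} {t} (h : Sem E F s T t)
    {f : α × Store K → Tr (β × Store K)}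
    (hf : ∀ g a s', t.Path g (a, s') → Sem E (G a) s' T' (f (a, s'))) :
    Sem E (F.bind G) s (T + T') (t.bind f) :=
  Sem.bind_map (v := fun p => p) (by rwa [Tr.map_id]) fun g p hp => hf g p.1 p.2 hp

lemma Sem.bind_ret [Finite α] {F : Frag K α} {G : α → Frag K β} {a s' t}
    (h : Sem E F s T (.ret (a, s'))) (h' : Sem E (G a) s' T' t) :
    Sem E (F.bind G) s (T + T') t :=
  Sem.bind (f := fun _ => t) h fun _ _ _ hp => by
    obtain ⟨-, hp⟩ := hp
    cases hp
    exact h'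

lemma Sem.guess_bind {G : Bool → Frag K β} {t₀ t₁} (h₀ : Sem E (G false) s T t₀)
    (h₁ : Sem E (G true) s T t₁) :
    Sem E ((Frag.guess id).bind G) s (1 + T) (.node t₀ t₁) :=
  Sem.bind (f := fun p => if p.1 then t₁ else t₀) (sem_guess id) fun g a s' hp => by
    obtain _ | ⟨b, g⟩ := g
    · simp at hp
    · cases b <;> simp at hp <;> simpa [hp]

lemma Sem.iter_map {γ : Type} [Finite σ] {F : σ → Frag K (σ ⊕ α)} {x : σ} {t : Tr γ}
    {v : γ → (σ ⊕ α) × Store K} (h : Sem E (F x) s T (t.map v)) {f : γ → Tr (α × Store K)}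
    (hl : ∀ g c y, t.Path g c → (v c).1 = .inl y → Sem E (iter F y) (v c).2 T' (f c))
    (hr : ∀ g c a, t.Path g c → (v c).1 = .inr a → f c = .ret (a, (v c).2)) :
    Sem E (iter F x) s (T + T') (t.bind f) := by
  refine Ev.trans (j := Sum.elim (fun l' => .inl ⟨x, l'⟩)
    (Sum.elim (fun x => .inl ⟨x, (F x).start⟩) .inr)) (φ := fun l' => ⟨x, l'⟩)
    (ins' := (Frag.iter F x).instr) (fun _ => rfl) (fun _ => rfl) h rfl fun g c hp => ?_
  rcases hv : (v c).1 with y | a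
  · exact hl g c y hp hv
  · rw [hr g c a hp hv]
    exact Ev.exit ..

lemma Sem.iter [Finite σ] {F : σ → Frag K (σ ⊕ α)} {x : σ} {t} (h : Sem E (F x) s T t)
    {f : (σ ⊕ α) × Store K → Tr (α × Store K)}
    (hl : ∀ g y s', t.Path g (.inl y, s') → Sem E (iter F y) s' T' (f (.inl y, s')))
    (hr : ∀ g a s', t.Path g (.inr a, s') → f (.inr a, s') = .ret (a, s')) :
    Sem E (iter F x) s (T + T') (t.bind f) := by
  refine Sem.iter_map (v := fun p => p) (by rwa [Tr.map_id]) ?_ ?_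
  · rintro g ⟨_, s'⟩ y hp rfl
    exact hl g y s' hp
  · rintro g ⟨_, s'⟩ a hp rfl
    exact hr g a s' hp

lemma Sem.iter_inl [Finite σ] {F : σ → Frag K (σ ⊕ α)} {x y : σ} {s' t}
    (h : Sem E (F x) s T (.ret (.inl y, s'))) (h' : Sem E (Frag.iter F y) s' T' t) :
    Sem E (Frag.iter F x) s (T + T') t :=
  Sem.iter (f := fun _ => t) h
    (fun _ _ _ hp => by
      obtain ⟨-, hp⟩ := hp
      cases hp
      exact h')
    (fun _ _ _ hp => by simp at hp)

lemma Sem.iter_inr [Finite σ] {F : σ → Frag K (σ ⊕ α)} {x : σ} {a s'}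
    (h : Sem E (F x) s T (.ret (.inr a, s'))) :
    Sem E (Frag.iter F x) s T (.ret (a, s')) :=
  Sem.iter (T' := 0) (f := fun _ => .ret (a, s')) h
    (fun _ _ _ hp => by simp at hp)
    (fun _ _ _ hp => by simp at hp; simp [hp])

/-- No single instruction goes on deterministically and leaves every store unchanged; a push undone
by a pop does. -/
lemma sem_pure (k : K) (a : α) : Sem E (pure k a) s 2 (.ret (a, s)) := by
  have := (sem_push (E := E) (s := s) k true ()).bind_ret
    (G := fun _ => pop k fun _ => a) (sem_pop k fun _ => a)
  simp at this
  exact this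

end Frag

/-! ### Inverting single steps of a computation -/

namespace OracleTM

variable {M : OracleTM} {A : Lang} {c c' d : M.Cfg} {g : List Bool} {n : ℕ}

lemma detStep_push {k b nx} (h : M.instr c.state = .push k b nx) :
    M.detStep A c = some ⟨nx, update c.stk k (b :: c.stk k)⟩ := by
  simp [detStep, h]

lemma detStep_pop {k nx} (h : M.instr c.state = .pop k nx) :
    M.detStep A c = some ⟨nx (c.stk k).head?, update c.stk k (c.stk k).tail⟩ := by
  simp [detStep, h]

open Classical in
lemma detStep_query {nx} (h : M.instr c.state = .query nx) :
    M.detStep A c =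
      some ⟨nx (decide (c.stk M.queryStack ∈ A)), update c.stk M.queryStack []⟩ := by
  simp [detStep, h]

lemma computes_det_iff (h : M.detStep A c = some c') :
    M.Computes A c g n d ↔ (g = [] ∧ n = 0 ∧ d = c) ∨ ∃ m, n = m + 1 ∧ M.Computes A c' g m d := by
  constructor
  · intro hc
    cases hc with
    | refl => simp
    | det hs h' =>
      rw [h] at hs
      cases hs
      exact .inr ⟨_, rfl, h'⟩
    | guess b hi h' => simp [detStep, hi] at h
  · rintro (⟨rfl, rfl, rfl⟩ | ⟨m, rfl, h'⟩)
    · exact .refl _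
    · exact .det h h'

lemma computes_guess_iff {nx : Bool → M.Λ} (h : M.instr c.state = .guess nx) :
    M.Computes A c g n d ↔ (g = [] ∧ n = 0 ∧ d = c) ∨
      ∃ m b g', n = m + 1 ∧ g = b :: g' ∧ M.Computes A ⟨nx b, c.stk⟩ g' m d := by
  constructor
  · intro hc
    cases hc with
    | refl => simp
    | det hs h' => simp [detStep, h] at hs
    | guess b hi h' =>
      rw [h] at hi
      cases hi
      exact .inr ⟨_, _, _, rfl, rfl, h'⟩
  · rintro (⟨rfl, rfl, rfl⟩ | ⟨m, b, g', rfl, rfl, h'⟩)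
    · exact .refl _
    · exact .guess b h h'

lemma computes_halt_iff (h : M.instr c.state = .accept ∨ M.instr c.state = .reject) :
    M.Computes A c g n d ↔ g = [] ∧ n = 0 ∧ d = c := by
  constructor
  · intro hc
    cases hc with
    | refl => simp
    | det hs h' => rcases h with h | h <;> simp [detStep, h] at hs
    | guess b hi h' => rcases h with h | h <;> simp [h] at hi
  · rintro ⟨rfl, rfl, rfl⟩
    exact .refl _

end OracleTM

/-! ### From fragments to machines -/

namespace Frag

variable {K : Type} [DecidableEq K] [Finite K]

/-- The machine that runs a fragment and accepts if the outcome is `true`. -/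
def toTM (F : Frag K Bool) (inp qs : K) : OracleTM where
  K := K
  Λ := F.Λ ⊕ Bool
  input := inp
  queryStack := qs
  start := .inl F.start
  instr
    | .inl l => F.instr l
    | .inr true => .accept
    | .inr false => .reject

variable {F : Frag K Bool} {inp : K} {E : Env K}

lemma computes_exit_iff {a : Bool} {s : Store K} {A g n d} :
    (F.toTM inp E.qs).Computes A ⟨.inr a, s⟩ g n d ↔ g = [] ∧ n = 0 ∧ d = ⟨.inr a, s⟩ :=
  OracleTM.computes_halt_iff (by cases a <;> simp [toTM])

/-- A computation may stop anywhere along a path. Hence one induction yields the time bound, the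
soundness of acceptance and the guard on queries, each read off at the configuration `d` where it
stops. -/
lemma _root_.Cplx.Ev.toTM {c s T t} (h : Ev E F.instr c s T t) (g : List Bool) (n : ℕ)
    (d : (F.toTM inp E.qs).Cfg) (hc : (F.toTM inp E.qs).Computes E.oracle ⟨c, s⟩ g n d) :
    n ≤ T ∧ ((F.toTM inp E.qs).instr d.state = .accept → ∃ s', t.Path g (true, s')) ∧
      ∀ nx, (F.toTM inp E.qs).instr d.state = .query nx → d.stk E.qs ∈ E.permitted := by
  induction h generalizing g n with
  | exit a s T =>
    rw [computes_exit_iff] at hc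
    obtain ⟨rfl, rfl, rfl⟩ := hc
    cases a
    · exact ⟨Nat.zero_le _, nofun, nofun⟩
    · exact ⟨Nat.zero_le _, fun _ => ⟨s, rfl, rfl⟩, nofun⟩
  | @reject l s T hi =>
    have hi' : (F.toTM inp E.qs).instr (.inl l) = .reject := hi
    obtain ⟨rfl, rfl, rfl⟩ := (OracleTM.computes_halt_iff (M := F.toTM inp E.qs) (c := ⟨.inl l, s⟩) (.inr hi')).1 hc
    exact ⟨Nat.zero_le _, fun h => (by cases hi'.symm.trans h),
      fun nx h => (by cases hi'.symm.trans h)⟩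
  | @push l k b nx s T t hi _ ih =>
    have hi' : (F.toTM inp E.qs).instr (.inl l) = .push k b nx := hi
    have hs := OracleTM.detStep_push (A := E.oracle) (M := F.toTM inp E.qs) (c := ⟨.inl l, s⟩) hi'
    obtain ⟨rfl, rfl, rfl⟩ | ⟨m, rfl, hc'⟩ := (OracleTM.computes_det_iff hs).1 hc
    · exact ⟨Nat.zero_le _, fun h => (by cases hi'.symm.trans h),
        fun nx h => (by cases hi'.symm.trans h)⟩
    · have := ih _ _ hc'
      exact ⟨by omega, this.2⟩
  | @pop l k nx s T t hi _ ih =>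
    have hi' : (F.toTM inp E.qs).instr (.inl l) = .pop k nx := hi
    have hs := OracleTM.detStep_pop (A := E.oracle) (M := F.toTM inp E.qs) (c := ⟨.inl l, s⟩) hi'
    obtain ⟨rfl, rfl, rfl⟩ | ⟨m, rfl, hc'⟩ := (OracleTM.computes_det_iff hs).1 hc
    · exact ⟨Nat.zero_le _, fun h => (by cases hi'.symm.trans h),
        fun nx h => (by cases hi'.symm.trans h)⟩
    · have := ih _ _ hc'
      exact ⟨by omega, this.2⟩
  | @query l nx s T t hi hq _ ih =>
    have hi' : (F.toTM inp E.qs).instr (.inl l) = .query nx := hi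
    have hs := OracleTM.detStep_query (A := E.oracle) (M := F.toTM inp E.qs) (c := ⟨.inl l, s⟩) hi'
    obtain ⟨rfl, rfl, rfl⟩ | ⟨m, rfl, hc'⟩ := (OracleTM.computes_det_iff hs).1 hc
    · exact ⟨Nat.zero_le _, fun h => (by cases hi'.symm.trans h),
        fun nx h => (by cases hi'.symm.trans h; exact hq)⟩
    · have := ih _ _ hc'
      exact ⟨by omega, this.2⟩
  | @guess l nx s T t₀ t₁ hi _ _ ih₀ ih₁ =>
    have hi' : (F.toTM inp E.qs).instr (.inl l) = .guess nx := hi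
    obtain ⟨rfl, rfl, rfl⟩ | ⟨m, b, g', rfl, rfl, hc'⟩ :=
      (OracleTM.computes_guess_iff (M := F.toTM inp E.qs) (c := ⟨.inl l, s⟩) hi').1 hc
    · exact ⟨Nat.zero_le _, fun h => (by cases hi'.symm.trans h),
        fun nx h => (by cases hi'.symm.trans h)⟩
    · cases b
      · have := ih₀ _ _ hc'
        exact ⟨by omega, by simpa using this.2⟩
      · have := ih₁ _ _ hc'
        exact ⟨by omega, by simpa using this.2⟩

lemma _root_.Cplx.Ev.toTM_path {c s T t} (h : Ev E F.instr c s T t) (g : List Bool)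
    (s' : Store K) (hp : t.Path g (true, s')) :
    ∃ n d, (F.toTM inp E.qs).Computes E.oracle ⟨c, s⟩ g n d ∧
      (F.toTM inp E.qs).instr d.state = .accept := by
  induction h generalizing g with
  | exit a s T =>
    obtain ⟨rfl, hp⟩ := hp
    cases hp
    exact ⟨0, _, .refl _, rfl⟩
  | reject hi => exact hp.elim
  | @push l k b nx s T t hi _ ih =>
    have hi' : (F.toTM inp E.qs).instr (.inl l) = .push k b nx := hi
    have hs := OracleTM.detStep_push (A := E.oracle) (M := F.toTM inp E.qs) (c := ⟨.inl l, s⟩) hi'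
    obtain ⟨n, d, hc, hd⟩ := ih _ hp
    exact ⟨n + 1, d, .det hs hc, hd⟩
  | @pop l k nx s T t hi _ ih =>
    have hi' : (F.toTM inp E.qs).instr (.inl l) = .pop k nx := hi
    have hs := OracleTM.detStep_pop (A := E.oracle) (M := F.toTM inp E.qs) (c := ⟨.inl l, s⟩) hi'
    obtain ⟨n, d, hc, hd⟩ := ih _ hp
    exact ⟨n + 1, d, .det hs hc, hd⟩
  | @query l nx s T t hi hq _ ih =>
    have hi' : (F.toTM inp E.qs).instr (.inl l) = .query nx := hi
    have hs := OracleTM.detStep_query (A := E.oracle) (M := F.toTM inp E.qs) (c := ⟨.inl l, s⟩) hi'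
    obtain ⟨n, d, hc, hd⟩ := ih _ hp
    exact ⟨n + 1, d, .det hs hc, hd⟩
  | @guess l nx s T t₀ t₁ hi _ _ ih₀ ih₁ =>
    have hi' : (F.toTM inp E.qs).instr (.inl l) = .guess nx := hi
    rcases g with _ | ⟨b, g⟩
    · simp at hp
    · cases b
      · obtain ⟨n, d, hc, hd⟩ := ih₀ g (by simpa using hp)
        exact ⟨n + 1, d, .guess false hi' hc, hd⟩
      · obtain ⟨n, d, hc, hd⟩ := ih₁ g (by simpa using hp)
        exact ⟨n + 1, d, .guess true hi' hc, hd⟩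

lemma Sem.acceptingPath_iff {x T t}
    (h : Sem E F (update (fun _ => []) inp x) T t) (g : List Bool) :
    (F.toTM inp E.qs).AcceptingPath E.oracle x g ↔ ∃ s', t.Path g (true, s') :=
  ⟨fun ⟨n, d, hc, hd⟩ => (h.toTM g n d hc).2.1 hd, fun ⟨s', hp⟩ => h.toTM_path g s' hp⟩

lemma Sem.queries_subset {x T t}
    (h : Sem E F (update (fun _ => []) inp x) T t) :
    (F.toTM inp E.qs).queries E.oracle x ⊆ E.permitted := by
  rintro q ⟨g, n, d, nx, hc, hd, rfl⟩
  exact (h.toTM g n d hc).2.2 nx hd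

/-- Polynomial time is required for every oracle, also for oracles whose answers break a promise.
The set `Q` of permitted queries may therefore depend on the oracle, and may be everything. -/
lemma polyTime_toTM {qs : K} (p : Polynomial ℕ)
    (h : ∀ A x, ∃ Q t, Sem ⟨qs, A, Q⟩ F (update (fun _ => []) inp x) (p.eval x.length) t) :
    (F.toTM inp qs).PolyTime := by
  refine ⟨p, fun A x g n d hc => ?_⟩
  obtain ⟨Q, t, hs⟩ := h A x
  exact (Ev.toTM (E := ⟨qs, A, Q⟩) hs g n d hc).1

end Frag

/-- `extend e f S` is the store in which the stacks embedded by `e` hold `f` and all others hold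
`S`. The lemma lets an instruction of an embedded machine be computed inside `f`. -/
lemma update_extend {ι κ γ : Type} [DecidableEq ι] [DecidableEq κ] {e : ι → κ}
    (he : Function.Injective e) (f : ι → γ) (S : κ → γ) (k : ι) (w : γ) :
    update (extend e f S) (e k) w = extend e (update f k w) S := by
  funext j
  by_cases hj : ∃ i, e i = j
  · obtain ⟨i, rfl⟩ := hj
    by_cases hi : i = k
    · subst hi
      simp [he.extend_apply]
    · simp [he.extend_apply, hi, he.ne hi]
  · have hjk : j ≠ e k := fun h => hj ⟨k, h.symm⟩
    rw [Function.extend_apply' _ _ _ hj, Function.update_of_ne hjk,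
      Function.extend_apply' _ _ _ hj]

/-! ### The choice tree of a machine -/

namespace OracleTM

variable {M : OracleTM} {A B : Lang} {c c' d : M.Cfg} {g : List Bool} {n : ℕ}

/-- The tree of the nondeterministic choices in the first `n` steps from `c`. -/
noncomputable def tree (M : OracleTM) (A : Lang) : ℕ → M.Cfg → Tr Bool
  | 0, _ => .fail
  | n + 1, c =>
    match M.instr c.state with
    | .accept => .ret true
    | .reject => .ret false
    | .guess nx => .node (tree M A n ⟨nx false, c.stk⟩) (tree M A n ⟨nx true, c.stk⟩)
    | _ => (M.detStep A c).elim .fail (tree M A n)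

lemma tree_accept (h : M.instr c.state = .accept) : M.tree A (n + 1) c = .ret true := by
  simp [tree, h]

lemma tree_reject (h : M.instr c.state = .reject) : M.tree A (n + 1) c = .ret false := by
  simp [tree, h]

lemma tree_guess {nx} (h : M.instr c.state = .guess nx) : M.tree A (n + 1) c =
    .node (M.tree A n ⟨nx false, c.stk⟩) (M.tree A n ⟨nx true, c.stk⟩) := by
  simp [tree, h]

lemma tree_det (h : M.detStep A c = some c') : M.tree A (n + 1) c = M.tree A n c' := by
  cases hi : M.instr c.state <;> simp_all [tree, detStep]

/-- Every instruction halts, branches, or has a unique successor. -/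
lemma instr_cases (M : OracleTM) (A : Lang) (c : M.Cfg) :
    M.instr c.state = .accept ∨ M.instr c.state = .reject ∨ (∃ nx, M.instr c.state = .guess nx) ∨
      ∃ c', M.detStep A c = some c' := by
  cases hi : M.instr c.state <;> simp [detStep, hi]

/-- The fuel `n` exceeds the length of every run, so the leaf `fail` for exhausted fuel is never
reached. -/
lemma path_tree_iff (h : ∀ g m d, M.Computes A c g m d → m < n) :
    (M.tree A n c).Path g true ↔ ∃ m d, M.Computes A c g m d ∧ M.instr d.state = .accept := by
  induction n generalizing c g with
  | zero => exact absurd (h _ _ _ (.refl c)) (Nat.lt_irrefl 0)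
  | succ n ih =>
    rcases M.instr_cases A c with hi | hi | ⟨nx, hi⟩ | ⟨c', hs⟩
    · rw [tree_accept hi]
      simp only [computes_halt_iff (.inl hi), Tr.path_ret]
      constructor
      · rintro ⟨rfl, -⟩
        exact ⟨0, c, ⟨rfl, rfl, rfl⟩, hi⟩
      · rintro ⟨m, d, ⟨rfl, -, -⟩, -⟩
        simp
    · rw [tree_reject hi]
      simp only [computes_halt_iff (.inr hi), Tr.path_ret]
      constructor
      · rintro ⟨-, hd⟩
        cases hd
      · rintro ⟨m, d, ⟨-, -, rfl⟩, hd⟩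
        cases hi.symm.trans hd
    · rw [tree_guess hi]
      have ih' (b : Bool) (g : List Bool) := @ih ⟨nx b, c.stk⟩ g
        fun g m d hc => Nat.lt_of_succ_lt_succ (h _ _ _ (.guess b hi hc))
      constructor
      · rcases g with _ | ⟨b, g⟩
        · simp
        · intro hp
          have hp' : (M.tree A n ⟨nx b, c.stk⟩).Path g true := by cases b <;> simpa using hp
          obtain ⟨m, d, hc, hd⟩ := (ih' b g).1 hp'
          exact ⟨m + 1, d, .guess b hi hc, hd⟩
      · rintro ⟨m, d, hc, hd⟩
        obtain ⟨-, -, rfl⟩ | ⟨m, b, g', rfl, rfl, hc'⟩ := (computes_guess_iff hi).1 hc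
        · cases hi.symm.trans hd
        · have := (ih' b g').2 ⟨m, d, hc', hd⟩
          cases b <;> simpa using this
    · rw [tree_det hs, ih fun g m d hc => Nat.lt_of_succ_lt_succ (h _ _ _ (.det hs hc))]
      constructor
      · rintro ⟨m, d, hc, hd⟩
        exact ⟨m + 1, d, .det hs hc, hd⟩
      · rintro ⟨m, d, hc, hd⟩
        obtain ⟨-, -, rfl⟩ | ⟨m, rfl, hc'⟩ := (computes_det_iff hs).1 hc
        · simp [detStep, hd] at hs
        · exact ⟨m, d, hc', hd⟩

lemma tree_eq_ret (hM : M.Deterministic) (h : ∀ g m d, M.Computes A c g m d → m < n) :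
    ∃ b, M.tree A n c = .ret b := by
  induction n generalizing c with
  | zero => exact absurd (h _ _ _ (.refl c)) (Nat.lt_irrefl 0)
  | succ n ih =>
    rcases M.instr_cases A c with hi | hi | ⟨nx, hi⟩ | ⟨c', hs⟩
    · exact ⟨true, tree_accept hi⟩
    · exact ⟨false, tree_reject hi⟩
    · exact absurd hi (hM _ _)
    · rw [tree_det hs]
      exact ih fun g m d hc => Nat.lt_of_succ_lt_succ (h _ _ _ (.det hs hc))

/-- Only the runs with oracle `A` need to be controlled: while the answers agree, the runs with
oracle `B` are the same runs. -/
lemma tree_congr (h : ∀ g m d nx, M.Computes A c g m d → M.instr d.state = .query nx →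
    (d.stk M.queryStack ∈ A ↔ d.stk M.queryStack ∈ B)) : M.tree A n c = M.tree B n c := by
  induction n generalizing c with
  | zero => rfl
  | succ n ih =>
    rcases M.instr_cases A c with hi | hi | ⟨nx, hi⟩ | ⟨c', hs⟩
    · rw [tree_accept hi, tree_accept hi]
    · rw [tree_reject hi, tree_reject hi]
    · rw [tree_guess hi, tree_guess hi]
      congr 1
      · exact ih fun g m d nx' hc => h _ _ d nx' (.guess false hi hc)
      · exact ih fun g m d nx' hc => h _ _ d nx' (.guess true hi hc)
    -- The run of length zero ends in `c`, so `h` covers a query asked right here.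
    · have hs' : M.detStep B c = some c' := by
        rw [← hs]
        cases hi : M.instr c.state with
        | query nx =>
          rw [detStep_query hi, detStep_query hi]
          rw [decide_eq_decide.2 (h _ _ _ _ (.refl c) hi)]
        | _ => simp only [detStep, hi]
      rw [tree_det hs, tree_det hs']
      exact ih fun g m d nx' hc => h _ _ d nx' (.det hs hc)

lemma Computes.length_le (h : M.Computes A c g n d) (k : M.K) :
    (d.stk k).length ≤ (c.stk k).length + n := by
  induction h with
  | refl c => simp
  | guess b hi h ih => exact ih.trans (by simp only; omega)
  | @det c c' d g n hs h ih =>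
    refine ih.trans ?_
    suffices (c'.stk k).length ≤ (c.stk k).length + 1 by omega
    cases hi : M.instr c.state with
    | push j b nx =>
      rw [detStep_push hi] at hs
      cases hs
      by_cases hk : k = j
      · subst hk; simp
      · simp [hk]
    | pop j nx =>
      rw [detStep_pop hi] at hs
      cases hs
      by_cases hk : k = j
      · subst hk; simp; omega
      · simp [hk]
    | query nx =>
      rw [detStep_query hi] at hs
      cases hs
      by_cases hk : k = M.queryStack
      · subst hk; simp
      · simp [hk]
    | guess nx => simp [detStep, hi] at hs
    | accept => simp [detStep, hi] at hs
    | reject => simp [detStep, hi] at hs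

lemma init_length_le (M : OracleTM) (x : Word) (k : M.K) :
    ((M.init x).stk k).length ≤ x.length := by
  by_cases hk : k = M.input
  · subst hk; simp [init]
  · simp [init, hk]

/-- All runs from `c` have fewer than `n` steps, the stacks never hold more than `L` symbols, and
only queries in `Q` are asked. -/
def Safe (M : OracleTM) (A : Lang) (n L : ℕ) (Q : Set Word) (c : M.Cfg) : Prop :=
  ∀ g m d, M.Computes A c g m d → m < n ∧ (∀ k, (d.stk k).length ≤ L) ∧
    ∀ nx, M.instr d.state = .query nx → d.stk M.queryStack ∈ Q

lemma Safe.det {L : ℕ} {Q : Set Word} (h : M.Safe A (n + 1) L Q c) (hs : M.detStep A c = some c') :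
    M.Safe A n L Q c' := fun g m d hc =>
  have := h g (m + 1) d (.det hs hc)
  ⟨Nat.lt_of_succ_lt_succ this.1, this.2⟩

lemma Safe.guess {L : ℕ} {Q : Set Word} (h : M.Safe A (n + 1) L Q c) {nx}
    (hi : M.instr c.state = .guess nx) (b : Bool) : M.Safe A n L Q ⟨nx b, c.stk⟩ := fun g m d hc =>
  have := h (b :: g) (m + 1) d (.guess b hi hc)
  ⟨Nat.lt_of_succ_lt_succ this.1, this.2⟩

/-- `p` bounds the running time of `M`, whatever the oracle. -/
def TimeBound (M : OracleTM) (p : Polynomial ℕ) : Prop :=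
  ∀ (A : Lang) (x : Word) (g : List Bool) (n : ℕ) (d : M.Cfg),
    M.Computes A (M.init x) g n d → n ≤ p.eval x.length

lemma TimeBound.safe {p : Polynomial ℕ} (h : M.TimeBound p) (A : Lang) (x : Word) :
    M.Safe A (p.eval x.length + 1) (x.length + p.eval x.length) (M.queries A x) (M.init x) := by
  intro g m d hc
  have hm := h A x g m d hc
  refine ⟨by omega, fun k => (hc.length_le k).trans (Nat.add_le_add (M.init_length_le x k) hm),
    fun nx hi => ⟨g, m, d, nx, hc, hi, rfl⟩⟩

/-- Each step adds at most one symbol to a stack. The bound makes the words of `S` up to polynomial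
length a full substitute for `S`. -/
lemma TimeBound.length_query_le {p : Polynomial ℕ} (h : M.TimeBound p) {A : Lang} {x q : Word}
    (hq : q ∈ M.queries A x) : q.length ≤ x.length + p.eval x.length := by
  obtain ⟨g, m, d, nx, hc, hi, rfl⟩ := hq
  exact (h.safe A x g m d hc).2.1 _

/-- The tree of all nondeterministic choices on input `x` of a machine with time bound `p`. -/
noncomputable def run (M : OracleTM) (p : Polynomial ℕ) (A : Lang) (x : Word) : Tr Bool :=
  M.tree A (p.eval x.length + 1) (M.init x)

lemma TimeBound.path_run_iff {p : Polynomial ℕ} (h : M.TimeBound p) {x : Word} :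
    (M.run p A x).Path g true ↔ M.AcceptingPath A x g :=
  path_tree_iff fun g m d hc => (h.safe A x g m d hc).1

-- Without branching and with enough fuel the tree is one leaf. An embedded deterministic machine is
-- thus a subroutine with a Boolean result, and adds no paths.
open Classical in
lemma TimeBound.run_eq_ret {p : Polynomial ℕ} (h : M.TimeBound p) (hM : M.Deterministic)
    (x : Word) : M.run p A x = .ret (decide (x ∈ M.lang A)) := by
  obtain ⟨b, hb⟩ := tree_eq_ret (A := A) hM fun g m d hc => (h.safe A x g m d hc).1
  rw [run, hb]
  congr 1
  have : b = true ↔ x ∈ M.lang A := by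
    simp only [lang, Set.mem_ofPred_eq, ← h.path_run_iff]
    simp [run, hb, eq_comm]
  rw [Bool.eq_iff_iff, this, decide_eq_true_iff]

lemma run_congr {p : Polynomial ℕ} {x : Word} (h : ∀ q ∈ M.queries A x, (q ∈ A ↔ q ∈ B)) :
    M.run p A x = M.run p B x :=
  tree_congr fun g m d nx hc hi => h _ ⟨g, m, d, nx, hc, hi, rfl⟩

end OracleTM

/-! ### Running a machine inside another one -/

namespace Frag

variable {K α β : Type} [DecidableEq K] {E : Env K} {S : Store K}

/-- Empty the stack `k`. -/
def clear (k : K) (a : α) : Frag K α :=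
  iter (σ := Unit) (fun _ => pop k fun o => o.elim (.inr a) fun _ => .inl ()) ()

lemma sem_clear (k : K) (a : α) :
    Sem E (clear k a) S ((S k).length + 1) (.ret (a, update S k [])) := by
  generalize hw : S k = w
  induction w generalizing S with
  | nil =>
    refine Sem.iter_inr ((sem_pop k _).congr (by simp) ?_)
    simp [hw]
  | cons b w ih =>
    have := ih (S := update S k w) (by simp)
    rw [Function.update_idem] at this
    rw [List.length_cons, Nat.add_right_comm, Nat.add_comm]
    refine Sem.iter_inl ((sem_pop k _).congr le_rfl ?_) this
    simp [hw]

/-- Empty the stacks in a list. -/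
def clearAll (l : List K) (k : K) (a : α) : Frag K α :=
  l.foldr (fun j F => (clear j ()).bind fun _ => F) (clear k a)

lemma sem_clearAll (l : List K) (k : K) (a : α) {L : ℕ} (hL : ∀ j ∈ k :: l, (S j).length ≤ L) :
    Sem E (clearAll l k a) S ((l.length + 1) * (L + 1))
      (.ret (a, fun j => if j ∈ k :: l then [] else S j)) := by
  induction l generalizing S with
  | nil =>
    refine (sem_clear k a).congr (by simpa using hL) ?_
    congr 2
    funext j
    by_cases hj : j = k <;> simp [hj]
  | cons i l ih =>
    have := ih (S := update S i []) fun j hj => by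
      by_cases hi : j = i
      · simp [hi]
      · rw [Function.update_of_ne hi]
        exact hL j (by simp at hj ⊢; tauto)
    refine ((sem_clear i ()).bind_ret this).congr ?_ ?_
    · have := hL i (by simp)
      simp only [List.length_cons]
      linarith
    · congr 2
      funext j
      by_cases hj : j = i <;> simp [hj]

section exec

variable (N : OracleTM) (e : N.K → K)

noncomputable def _root_.Cplx.OracleTM.keys (N : OracleTM) : List N.K :=
  (@Finset.univ N.K (Fintype.ofFinite _)).toList

lemma _root_.Cplx.OracleTM.mem_keys (k : N.K) : k ∈ N.keys := by
  simp [OracleTM.keys]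

/-- Clearing the stacks at a halt allows repeated calls: an embedded machine may be started once for
every query of its caller. -/
noncomputable def execBody (h : Frag K Bool) (l : N.Λ) : Frag K (N.Λ ⊕ Bool) :=
  match N.instr l with
  | .push k b nx => push (e k) b (.inl nx)
  | .pop k nx => pop (e k) fun o => .inl (nx o)
  | .guess nx => guess fun b => .inl (nx b)
  | .query nx => h.map fun b => .inl (nx b)
  | .accept => clearAll (N.keys.map e) (e N.input) (.inr true)
  | .reject => clearAll (N.keys.map e) (e N.input) (.inr false)

/-- Run the machine `N`, whose stacks are embedded by `e`, where `h` answers the queries; clear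
the stacks of `N` in the end. -/
noncomputable def exec (h : Frag K Bool) : N.Λ → Frag K Bool := iter (execBody N e h)

variable {N e} {h : Frag K Bool} {B : Lang} {Q : Set Word} {H L : ℕ}

lemma sem_clear_keys (he : Function.Injective e) {stk : Store N.K} (a : α)
    (hL : ∀ k, (stk k).length ≤ L) :
    Sem E (clearAll (N.keys.map e) (e N.input) a) (extend e stk S)
      ((N.keys.length + 1) * (L + 1)) (.ret (a, extend e (fun _ => []) S)) := by
  refine (sem_clearAll (L := L) _ _ _ ?_).congr (by simp) ?_
  · intro j hj
    obtain ⟨k, rfl⟩ : ∃ k, e k = j := by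
      rcases List.mem_cons.1 hj with rfl | hj
      · exact ⟨_, rfl⟩
      · obtain ⟨k, -, hk⟩ := List.mem_map.1 hj
        exact ⟨k, hk⟩
    rw [he.extend_apply]
    exact hL k
  · congr 2
    funext j
    by_cases hj : ∃ k, e k = j
    · obtain ⟨k, rfl⟩ := hj
      rw [he.extend_apply, he.extend_apply, if_pos]
      exact List.mem_cons_of_mem _ (List.mem_map_of_mem (N.mem_keys k))
    · rw [Function.extend_apply' _ _ _ hj, Function.extend_apply' _ _ _ hj, ite_eq_right_iff]
      intro h
      rcases List.mem_cons.1 h with rfl | h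
      · exact absurd ⟨_, rfl⟩ hj
      · obtain ⟨k, -, hk⟩ := List.mem_map.1 h
        exact absurd ⟨k, hk⟩ hj

-- By `hh`, the fragment `h` acts like a query instruction with oracle `B` and leaves the foreign
-- stacks alone. Each of the `n` simulated steps costs at most `H + 1`; the second summand pays for
-- clearing the stacks. The whole choice tree is reproduced, so the number of accepting paths is
-- kept.
open Classical in
lemma sem_exec (he : Function.Injective e)
    (hh : ∀ stk : Store N.K, stk N.queryStack ∈ Q → Sem E h (extend e stk S) H
      (.ret (decide (stk N.queryStack ∈ B), extend e (update stk N.queryStack []) S)))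
    (n : ℕ) (c : N.Cfg) (hc : N.Safe B n L Q c) :
    Sem E (exec N e h c.state) (extend e c.stk S) (n * (H + 1) + (N.keys.length + 1) * (L + 1))
      ((N.tree B n c).map fun b => (b, extend e (fun _ => []) S)) := by
  induction n generalizing c with
  | zero => exact absurd (hc _ _ _ (.refl c)).1 (Nat.lt_irrefl 0)
  | succ n ih =>
    have h₀ := hc _ _ _ (.refl c)
    cases hi : N.instr c.state with
    | accept =>
      rw [OracleTM.tree_accept hi]
      refine Sem.iter_inr ?_
      simp only [execBody, hi]
      exact (sem_clear_keys he _ h₀.2.1).mono (by omega)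
    | reject =>
      rw [OracleTM.tree_reject hi]
      refine Sem.iter_inr ?_
      simp only [execBody, hi]
      exact (sem_clear_keys he _ h₀.2.1).mono (by omega)
    | guess nx =>
      rw [OracleTM.tree_guess hi]
      have hg : Sem E (execBody N e h c.state) (extend e c.stk S) 1
          (.node (.ret (.inl (nx false), extend e c.stk S))
            (.ret (.inl (nx true), extend e c.stk S))) := by
        simp only [execBody, hi]
        exact sem_guess _
      refine (Sem.iter hg (T' := n * (H + 1) + (N.keys.length + 1) * (L + 1)) (f := fun p => p.1.elim
        (fun l => (N.tree B n ⟨l, c.stk⟩).map fun b => (b, extend e (fun _ => []) S))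
        fun a => .ret (a, p.2)) ?_ fun _ _ _ _ => rfl).congr ?_ rfl
      · rintro g y s' hp
        have : ∃ b, y = nx b ∧ s' = extend e c.stk S := by
          rcases g with _ | ⟨b, g⟩
          · simp at hp
          · exact ⟨b, by cases b <;> simp at hp <;> simp [hp]⟩
        obtain ⟨b, rfl, rfl⟩ := this
        exact ih ⟨nx b, c.stk⟩ (hc.guess hi b)
      · linarith
    | push k b nx =>
      have hs := OracleTM.detStep_push (A := B) hi
      rw [OracleTM.tree_det hs]
      refine (Sem.iter_inl (T := 1) (y := nx) ?_ (ih _ (hc.det hs))).mono (by linarith)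
      simp only [execBody, hi]
      refine (sem_push _ _ _).congr le_rfl ?_
      rw [he.extend_apply, update_extend he]
    | pop k nx =>
      have hs := OracleTM.detStep_pop (A := B) hi
      rw [OracleTM.tree_det hs]
      refine (Sem.iter_inl (T := 1) (y := nx (c.stk k).head?) ?_
        (ih _ (hc.det hs))).mono (by linarith)
      simp only [execBody, hi]
      refine (sem_pop _ _).congr le_rfl ?_
      rw [he.extend_apply, update_extend he]
    | query nx =>
      have hs := OracleTM.detStep_query (A := B) hi
      rw [OracleTM.tree_det hs]
      refine (Sem.iter_inl (T := H) (y := nx (decide (c.stk N.queryStack ∈ B))) ?_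
        (ih _ (hc.det hs))).mono (by linarith)
      simp only [execBody, hi]
      exact (hh c.stk (h₀.2.2 nx hi)).map _

open Classical in
/-- Running an embedded machine from the start. -/
lemma sem_exec_start (he : Function.Injective e) {p : Polynomial ℕ} (hp : N.TimeBound p) (x : Word)
    (hh : ∀ stk : Store N.K, stk N.queryStack ∈ N.queries B x → Sem E h (extend e stk S) H
      (.ret (decide (stk N.queryStack ∈ B), extend e (update stk N.queryStack []) S))) :
    Sem E (exec N e h N.start) (extend e (update (fun _ => []) N.input x) S)
      ((p.eval x.length + 1) * (H + 1) +
        (N.keys.length + 1) * (x.length + p.eval x.length + 1))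
      ((N.run p B x).map fun b => (b, extend e (fun _ => []) S)) :=
  sem_exec he hh _ (N.init x) (hp.safe B x)

end exec

end Frag

lemma eval_mono (p : Polynomial ℕ) {a b : ℕ} (h : a ≤ b) : p.eval a ≤ p.eval b := by
  rw [Polynomial.eval_eq_sum, Polynomial.eval_eq_sum, Polynomial.sum, Polynomial.sum]
  exact Finset.sum_le_sum fun i _ => Nat.mul_le_mul_left _ (Nat.pow_le_pow_left h i)

/-! ### Moving and copying stacks -/

namespace Frag

variable {K α : Type} [DecidableEq K] {E : Env K} {s : Store K}

lemma Sem.to {F : Frag K α} {T T' : ℕ} {a a' : α} {s' s'' : Store K}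
    (h : Sem E F s T (.ret (a, s'))) (hT : T ≤ T') (ha : a = a') (hs : ∀ k, s' k = s'' k) :
    Sem E F s T' (.ret (a', s'')) := by
  obtain rfl := funext hs
  exact ha ▸ h.mono hT

/-- Move the content of the stack `src`, symbol by symbol, to the stack `dst`. -/
def move (src dst : K) (a : α) : Frag K α :=
  iter (fun o : Option Bool => o.elim (pop src fun o => o.elim (.inr a) fun b => .inl (some b))
    fun b => push dst b (.inl none)) none

lemma sem_move {src dst : K} (h : src ≠ dst) (a : α) :
    Sem E (move src dst a) s (2 * (s src).length + 1)
      (.ret (a, update (update s src []) dst ((s src).reverse ++ s dst))) := by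
  generalize hw : s src = w
  induction w generalizing s with
  | nil =>
    refine Sem.iter_inr ((sem_pop src _).congr (by simp) ?_)
    simp [hw, h.symm]
  | cons b w ih =>
    have h₁ := ih (s := update (update s src w) dst (b :: s dst)) (by simp [h])
    refine (Sem.iter_inl (T := 1) (y := some b) (s' := update s src w)
      (Sem.to (sem_pop src _) le_rfl (by simp [hw]) (by simp [hw])) (Sem.iter_inl (T := 1)
        (Sem.to (sem_push dst b _) le_rfl rfl fun k => ?_)
        (Sem.to h₁ le_rfl rfl fun k => ?_))).mono (by simp; omega)
    · simp [h.symm]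
    · simp only [Function.update_apply]
      split_ifs <;> simp_all

/-- Move the content of the stack `src` to the stack `d₁` and its image under `f` to `d₂`. -/
def moveTwo (src d₁ d₂ : K) (f : Bool → Bool) (a : α) : Frag K α :=
  iter (fun o : Option Bool => o.elim (pop src fun o => o.elim (.inr a) fun b => .inl (some b))
    fun b => (push d₁ b ()).bind fun _ => push d₂ (f b) (.inl none)) none

lemma sem_moveTwo {src d₁ d₂ : K} (h₁ : src ≠ d₁) (h₂ : src ≠ d₂) (h₁₂ : d₁ ≠ d₂)
    (f : Bool → Bool) (a : α) :
    Sem E (moveTwo src d₁ d₂ f a) s (3 * (s src).length + 1)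
      (.ret (a, update (update (update s src []) d₁ ((s src).reverse ++ s d₁)) d₂
        (((s src).map f).reverse ++ s d₂))) := by
  generalize hw : s src = w
  induction w generalizing s with
  | nil =>
    refine Sem.iter_inr ((sem_pop src _).congr (by simp) ?_)
    simp only [hw, List.head?_nil, Option.elim_none, List.tail_nil, List.reverse_nil,
      List.nil_append, List.map_nil]
    congr 2
    funext k
    simp only [Function.update_apply]
    split_ifs <;> simp_all
  | cons b w ih =>
    have h := ih (s := update (update (update s src w) d₁ (b :: s d₁)) d₂ (f b :: s d₂))
      (by simp [h₁, h₂])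
    refine (Sem.iter_inl (T := 1) (y := some b) (s' := update s src w)
      (Sem.to (sem_pop src _) le_rfl (by simp [hw]) (by simp [hw]))
      (Sem.iter_inl (T := 1 + 1)
        (show Sem E ((push d₁ b ()).bind fun _ => push d₂ (f b) (.inl none : _ ⊕ α)) _ _ _ from
          Sem.bind_ret (sem_push d₁ b ()) (Sem.to (sem_push d₂ (f b) _) le_rfl rfl fun k => ?_))
        (Sem.to h le_rfl rfl fun k => ?_))).mono (by simp; omega)
    · simp only [Function.update_apply]
      split_ifs <;> simp_all
    · simp only [Function.update_apply]
      split_ifs <;> simp_all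

/-- Copy the image of the stack `src` under `f` to `dst`, using the empty stack `tmp`. -/
def copy (src tmp dst : K) (f : Bool → Bool) (a : α) : Frag K α :=
  (move src tmp ()).bind fun _ => moveTwo tmp src dst f a

lemma sem_copy {src tmp dst : K} (h₁ : src ≠ tmp) (h₂ : src ≠ dst) (h₃ : tmp ≠ dst)
    (f : Bool → Bool) (a : α) (ht : s tmp = []) :
    Sem E (copy src tmp dst f a) s (5 * (s src).length + 2)
      (.ret (a, update s dst ((s src).map f ++ s dst))) := by
  refine ((sem_move h₁ ()).bind_ret (sem_moveTwo h₁.symm h₃ h₂ f a)).congr ?_ ?_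
  · simp [ht]; omega
  · congr 2
    funext k
    simp only [Function.update_apply]
    split_ifs <;> simp_all

end Frag

/-! ### Composition with a deterministic machine -/

namespace OracleTM

open Polynomial in
/-- A bound for the time in which `N` is executed as a part of another machine, when `H` bounds
the time for answering a query. -/
noncomputable def execTime (N : OracleTM) (p H : ℕ[X]) : ℕ[X] :=
  (p + 1) * (H + 1) + C (N.keys.length + 1) * (X + p + 1)

lemma eval_execTime (N : OracleTM) (p H : Polynomial ℕ) (n : ℕ) :
    (N.execTime p H).eval n =
      (p.eval n + 1) * (H.eval n + 1) + (N.keys.length + 1) * (n + p.eval n + 1) := by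
  simp [execTime]

section comp

variable (N M : OracleTM)

/-- The fragment that runs `N` and answers its queries by running `M`. -/
noncomputable def compFrag : Frag (N.K ⊕ Option M.K) Bool :=
  Frag.exec N .inl
    ((Frag.move (.inl N.queryStack) (.inr none) ()).bind fun _ =>
      (Frag.move (.inr none) (.inr (some M.input)) ()).bind fun _ =>
        Frag.exec M (fun k => .inr (some k)) (Frag.query id) M.start) N.start

/-- The machine `N` with its queries answered by the machine `M`. -/
noncomputable def comp : OracleTM :=
  (compFrag N M).toTM (.inl N.input) (.inr (some M.queryStack))

-- A query of `N` has at most X + p symbols, and moving it twice costs 4(X + p) + 2. The queries of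
-- `M` are passed on in one step, hence `execTime q 1`.
open Polynomial in
noncomputable def compTime (p q : ℕ[X]) : ℕ[X] :=
  N.execTime p (4 * (X + p) + 2 + (M.execTime q 1).comp (X + p))

variable {N M} {p q : Polynomial ℕ}

/-- One move reverses a word, so a query travels to the input of `M` over the scratch stack `.inr
none`. As `M` is deterministic, its run is a single leaf, and the tree of `N` with oracle `M.lang A`
survives unchanged. -/
lemma sem_comp (hN : N.TimeBound p) (hM : M.TimeBound q) (hd : M.Deterministic) (A : Lang)
    (x : Word) :
    Frag.Sem ⟨.inr (some M.queryStack), A, ⋃ y ∈ N.queries (M.lang A) x, M.queries A y⟩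
      (compFrag N M) (update (fun _ => []) (.inl N.input) x) ((compTime N M p q).eval x.length)
      ((N.run p (M.lang A) x).map fun b => (b, fun _ => [])) := by
  classical
  set E : Env (N.K ⊕ Option M.K) :=
    ⟨.inr (some M.queryStack), A, ⋃ y ∈ N.queries (M.lang A) x, M.queries A y⟩ with hE
  set e₂ : M.K → N.K ⊕ Option M.K := fun k => .inr (some k) with he₂
  have he₂i : Function.Injective e₂ := fun a b h => by simpa [he₂] using h
  have h₂ (f : Store M.K) (S : Store (N.K ⊕ Option M.K)) (k : M.K) :
      extend e₂ f S (.inr (some k)) = f k := he₂i.extend_apply f S k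
  have h₂n (f : Store M.K) (S : Store (N.K ⊕ Option M.K)) :
      extend e₂ f S (.inr none) = S (.inr none) :=
    Function.extend_apply' _ _ _ (by simp [he₂])
  have h₂l (f : Store M.K) (S : Store (N.K ⊕ Option M.K)) (k : N.K) :
      extend e₂ f S (.inl k) = S (.inl k) := Function.extend_apply' _ _ _ (by simp [he₂])
  have h₁ (f : Store N.K) (S : Store (N.K ⊕ Option M.K)) (k : N.K) :
      extend Sum.inl f S (.inl k) = f k := Sum.inl_injective.extend_apply f S k
  have h₁r (f : Store N.K) (S : Store (N.K ⊕ Option M.K)) (k : Option M.K) :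
      extend Sum.inl f S (.inr k) = S (.inr k) := Function.extend_apply' _ _ _ (by simp)
  have hinit : update (fun _ => []) (.inl N.input) x =
      extend (Sum.inl : N.K → N.K ⊕ Option M.K) (update (fun _ => []) N.input x) fun _ => [] := by
    rw [← update_extend Sum.inl_injective]
    congr 1
    funext k
    rcases k with k | k
    · rw [h₁]
    · rw [h₁r]
  rw [hinit]
  refine ((Frag.sem_exec_start (E := E) (S := fun _ => []) (B := M.lang A)
    (H := (4 * (.X + p) + 2 + (M.execTime q 1).comp (.X + p) : Polynomial ℕ).eval x.length)
    Sum.inl_injective hN x ?_).congr ?_ ?_)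
  · intro stk hy
    set y := stk N.queryStack with hyd
    have hlen := hN.length_query_le hy
    have hs₂ : extend e₂ (update (fun _ => []) M.input y)
        (extend .inl (update stk N.queryStack []) fun _ => []) =
        update (update (extend .inl (update stk N.queryStack []) fun _ => []) (.inr none) [])
          (.inr (some M.input)) y := by
      funext k
      rcases k with k | _ | k
      · simp
      · simp [h₂n]
      · rw [h₂]
        by_cases hk : k = M.input
        · simp [hk]
        · simp [hk]
    refine Frag.Sem.mono (Frag.Sem.bind_ret (Frag.sem_move (by simp) ()) (Frag.Sem.bind_ret
      (s' := extend e₂ (update (fun _ => []) M.input y)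
        (extend .inl (update stk N.queryStack []) fun _ => []))
      (Frag.Sem.to (Frag.sem_move (by simp) ()) le_rfl rfl fun k => ?_)
      (Frag.Sem.congr (Frag.sem_exec_start (E := E) (B := A) (H := 1)
        (S := extend .inl (update stk N.queryStack []) fun _ => []) he₂i hM y ?_)
          le_rfl ?_))) ?_
    · rw [hs₂]
      rcases k with k | _ | k
      · by_cases hk : k = N.queryStack <;> simp [hk, h₁]
      · simp
      · by_cases hk : k = M.input <;> simp [hk, h₁, hyd]
    · intro stk' hq
      refine (Frag.sem_query id ?_).congr le_rfl ?_
      · simp only [hE, h₂, Set.mem_iUnion]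
        exact ⟨y, hy, hq⟩
      · simp only [hE, h₂, id]
        rw [← update_extend he₂i]
    · rw [hM.run_eq_ret hd]
      simp only [Tr.map_ret]
      congr 2
      funext k
      rcases k with k | _ | k
      · rw [h₂l]
      · rw [h₂n]
      · rw [h₂, h₁r]
    · simp only [h₁, h₁r, ← hyd, Function.update_self, Polynomial.eval_add, Polynomial.eval_mul,
        Polynomial.eval_comp, eval_execTime, Polynomial.eval_X, Polynomial.eval_ofNat]
      have := eval_mono q hlen
      have h₃ := Nat.mul_le_mul_right (1 + 1) (Nat.add_le_add_right this 1)
      have h₄ := Nat.mul_le_mul_left (M.keys.length + 1)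
        (Nat.add_le_add_right (Nat.add_le_add hlen this) 1)
      simp only [Polynomial.eval_one, List.length_append, List.length_reverse, List.length_nil]
      omega
  · exact (eval_execTime _ _ _ _).ge
  · congr 1
    funext b
    congr 1
    funext k
    rcases k with k | k
    · rw [h₁]
    · rw [h₁r]

lemma polyTime_comp (hN : N.TimeBound p) (hM : M.TimeBound q) (hd : M.Deterministic) :
    (comp N M).PolyTime :=
  Frag.polyTime_toTM (compTime N M p q) fun A x => ⟨_, _, sem_comp hN hM hd A x⟩

lemma acceptingPath_comp_iff (hN : N.TimeBound p) (hM : M.TimeBound q) (hd : M.Deterministic)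
    (A : Lang) (x : Word) (g : List Bool) :
    (comp N M).AcceptingPath A x g ↔ N.AcceptingPath (M.lang A) x g := by
  refine ((sem_comp hN hM hd A x).acceptingPath_iff g).trans ?_
  rw [← hN.path_run_iff]
  simp [Tr.path_map]

lemma lang_comp (hN : N.TimeBound p) (hM : M.TimeBound q) (hd : M.Deterministic) (A : Lang) :
    (comp N M).lang A = N.lang (M.lang A) := by
  ext x
  exact exists_congr fun g => acceptingPath_comp_iff hN hM hd A x g

lemma unambiguousAt_comp_iff (hN : N.TimeBound p) (hM : M.TimeBound q) (hd : M.Deterministic)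
    (A : Lang) (x : Word) :
    (comp N M).UnambiguousAt A x ↔ N.UnambiguousAt (M.lang A) x := by
  simp only [UnambiguousAt, acceptingPath_comp_iff hN hM hd]

lemma queries_comp_subset (hN : N.TimeBound p) (hM : M.TimeBound q) (hd : M.Deterministic)
    (A : Lang) (x : Word) :
    (comp N M).queries A x ⊆ ⋃ y ∈ N.queries (M.lang A) x, M.queries A y :=
  (sem_comp hN hM hd A x).queries_subset

end comp

end OracleTM

/-! ### The inclusions between the hierarchies -/

lemma USigma_one_subset_UP : USigma 1 ⊆ UP := by
  rintro L ⟨A, ⟨M, ⟨q, hM⟩, hd, rfl⟩, N, ⟨p, hN⟩, hu, rfl⟩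
  exact ⟨N.comp M, OracleTM.polyTime_comp hN hM hd,
    fun x => (OracleTM.unambiguousAt_comp_iff hN hM hd _ x).2 (hu x),
    (OracleTM.lang_comp hN hM hd _).symm⟩

lemma UPRelClass_mono {C D : Set Lang} (h : C ⊆ D) : UPRelClass C ⊆ UPRelClass D :=
  fun _ ⟨A, hA, hL⟩ => ⟨A, h hA, hL⟩

/-- The deterministic `M` is absorbed into the upper machine `N` without adding paths. What the
composition asks is asked by `M` on some input, and there the guard of P^𝒰P holds whatever that
input is. -/
lemma UPRelClass_PPromiseUP_subset : UPRelClass PPromiseUP ⊆ PromiseUSigma 2 := by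
  rintro L ⟨A, ⟨M, N', ⟨q, hM⟩, hd, hN', rfl, hg⟩, N, ⟨p, hN⟩, hu, rfl⟩
  refine ⟨[N.comp M, N'], rfl, by simpa using ⟨OracleTM.polyTime_comp hN hM hd, hN'⟩,
    (OracleTM.lang_comp hN hM hd _).symm,
    fun x => ⟨(OracleTM.unambiguousAt_comp_iff hN hM hd _ x).2 (hu x), fun y hy => ?_⟩⟩
  obtain ⟨z, -, hz⟩ := Set.mem_iUnion₂.1 (OracleTM.queries_comp_subset hN hM hd _ x hy)
  exact ⟨hg z y hz, fun _ _ => trivial⟩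

/-- The lower tower is guarded on every word, so it does not matter what the new top machine asks.
-/
lemma UPRelClass_PromiseUSigma_subset (k : ℕ) :
    UPRelClass (PromiseUSigma (k + 2)) ⊆ PromiseUSigma (k + 3) := by
  rintro L ⟨A, ⟨Ns, hl, hp, rfl, hg⟩, N, hN, hu, rfl⟩
  refine ⟨N :: Ns, by simp [hl], by simpa using ⟨hN, hp⟩, rfl, fun x => ⟨hu x, fun q _ => hg q⟩⟩

theorem USigma_subset_of_UPRelClass_UP_subset (h : UPRelClass UP ⊆ PPromiseUP) (k : ℕ) :
    USigma (k + 3) ⊆ PromiseUSigma (k + 2) := by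
  induction k with
  | zero =>
    -- The third level is UP over UP over UΣ₁; UΣ₁ is replaced by UP, then UP over UP by P^𝒰P.
    exact (UPRelClass_mono ((UPRelClass_mono USigma_one_subset_UP).trans h)).trans
      UPRelClass_PPromiseUP_subset
  | succ k ih => exact (UPRelClass_mono ih).trans (UPRelClass_PromiseUSigma_subset k)

/-! ### Comparing words and coding lists of words -/

/-- Lexicographic comparison of words, where `o` is the result on the part already read. -/
def lexCmp : Ordering → Word → Word → Ordering
  | o, [], [] => o
  | o, [], _ :: _ => o.then .lt
  | o, _ :: e, [] => lexCmp (o.then .gt) e []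
  | o, a :: e, b :: q => lexCmp (o.then (compare a b)) e q

/-- A difference once found is final. The scan still goes on to the end of `e`, because the machine
has to consume the whole code of `e`. -/
lemma lexCmp_ne_eq {o : Ordering} (ho : o ≠ .eq) (e q : Word) : lexCmp o e q = o := by
  have ht (o' : Ordering) : o.then o' = o := by cases o <;> simp_all
  induction e generalizing q with
  | nil => cases q <;> simp [lexCmp, ht]
  | cons a e ih => cases q <;> simp [lexCmp, ht, ih]

lemma lexCmp_eq_iff {e q : Word} : lexCmp .eq e q = .eq ↔ e = q := by
  induction e generalizing q with
  | nil => cases q <;> simp [lexCmp]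
  | cons a e ih =>
    cases q with
    | nil => simp [lexCmp, lexCmp_ne_eq]
    | cons b q =>
      simp only [lexCmp, Ordering.eq_then]
      cases a <;> cases b <;> simp [ih, lexCmp_ne_eq, compare]

lemma lexCmp_lt_iff {e q : Word} : lexCmp .eq e q = .lt ↔ e < q := by
  induction e generalizing q with
  | nil => cases q <;> simp [lexCmp]
  | cons a e ih =>
    cases q with
    | nil => simp [lexCmp, lexCmp_ne_eq]
    | cons b q =>
      simp only [lexCmp, Ordering.eq_then]
      cases a <;> cases b <;>
        simp [ih, lexCmp_ne_eq, compare, List.cons_lt_cons_iff]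

/-- The self-delimiting code of a word. -/
def enc (w : Word) : Word := w.flatMap (fun b => [true, b]) ++ [false]

/-- The code of a list of words. -/
def encList (l : List Word) : Word := l.flatMap enc

@[simp] lemma enc_nil : enc [] = [false] := rfl
@[simp] lemma enc_cons (b : Bool) (w : Word) : enc (b :: w) = true :: b :: enc w := rfl
@[simp] lemma encList_nil : encList [] = [] := rfl
@[simp] lemma encList_cons (w : Word) (l : List Word) : encList (w :: l) = enc w ++ encList l := rfl
@[simp] lemma length_enc (w : Word) : (enc w).length = 2 * w.length + 1 := by
  induction w with
  | nil => rfl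
  | cons b w ih => simp [ih]; omega

lemma encList_append (l l' : List Word) : encList (l ++ l') = encList l ++ encList l' :=
  List.flatMap_append

lemma length_encList_le {l : List Word} {m : ℕ} (h : ∀ w ∈ l, w.length ≤ m) :
    (encList l).length ≤ l.length * (2 * m + 1) := by
  induction l with
  | nil => simp
  | cons w l ih =>
    have := ih fun w hw => h w (by simp [hw])
    have := h w (by simp)
    simp only [encList_cons, List.length_append, length_enc, List.length_cons]
    linarith

namespace Frag

variable {K α : Type} [DecidableEq K] {E : Env K} {s : Store K}

/-- One round of the comparison of the first word on `T` with the word on `Q`. -/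
def cmpBody (T T' Q Q' : K) (o : Ordering) : Frag K (Ordering ⊕ Option Ordering) :=
  (pop T id).bind fun
    | none => pure T (.inr none)
    | some false => (push T' false ()).bind fun _ => (pop Q id).bind fun
      | none => pure Q (.inr (some o))
      | some b => push Q b (.inr (some (o.then .lt)))
    | some true => (pop T id).bind fun a => (push T' true ()).bind fun _ =>
      (push T' (a.getD false) ()).bind fun _ => (pop Q id).bind fun
        | none => pure Q (.inl (o.then .gt))
        | some b => push Q' b (.inl (o.then (compare (a.getD false) b)))

/-- Compare the first word on `T` with the word on `Q`; move the former to `T'`. -/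
def cmp (T T' Q Q' : K) : Frag K (Option Ordering) :=
  (iter (cmpBody T T' Q Q') .eq).bind fun r => move Q' Q r

lemma sem_cmp_nil {T T' Q Q' : K} (h : [T, T', Q, Q'].Nodup) (hT : s T = [])
    (hQ' : s Q' = []) : Sem E (cmp T T' Q Q') s 4 (.ret (none, s)) := by
  simp at h
  refine Sem.mono (T := 3 + 1) (Sem.bind_ret (s' := s) (Sem.iter_inr (a := none)
    (Sem.bind_ret (T := 1) (T' := 2) (a := none) (s' := s)
      (Sem.to (sem_pop T id) le_rfl (by simp [hT]) ?_) (sem_pure T _)))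
    (Sem.to (sem_move (by tauto) _) (by simp [hQ']) rfl ?_)) le_rfl
  · intro k
    by_cases hk : k = T <;> simp_all
  · intro k
    by_cases hk : k = Q
    · simp [hk, hQ']
    · by_cases hk' : k = Q' <;> simp_all

/-- What has been read is kept in reverse on `T'` and `Q'`. In a code every `true` is followed by a
symbol, so the default in `a.getD false` is not used. A round takes at most seven steps. -/
lemma sem_iter_cmpBody {T T' Q Q' : K} (h : [T, T', Q, Q'].Nodup) (o : Ordering) {e q r : Word}
    (hT : s T = enc e ++ r) (hQ : s Q = q) :
    Sem E (iter (cmpBody T T' Q Q') o) s (7 * e.length + 6)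
      (.ret (some (lexCmp o e q), update (update (update (update s T r) T' ((enc e).reverse ++ s T'))
        Q (q.drop e.length)) Q' ((q.take e.length).reverse ++ s Q'))) := by
  simp at h
  obtain ⟨⟨h₁, h₂, h₃⟩, ⟨h₄, h₅⟩, h₆⟩ := h
  have g₁ := Ne.symm h₁
  have g₂ := Ne.symm h₂
  have g₃ := Ne.symm h₃
  have g₄ := Ne.symm h₄
  have g₅ := Ne.symm h₅
  have g₆ := Ne.symm h₆
  induction e generalizing s o q with
  | nil =>
    refine Sem.iter_inr (Sem.mono (T := 1 + (1 + (1 + 2))) (Sem.bind_ret (a := some false)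
      (s' := update s T r) (Sem.to (sem_pop T id) le_rfl (by simp [hT]) (by simp [hT]))
      (Sem.bind_ret (sem_push T' false ()) ?_)) (by omega))
    cases q with
    | nil =>
      refine Sem.bind_ret (a := none) (Sem.to (sem_pop Q id) le_rfl ?_ fun _ => rfl)
        (Sem.to (sem_pure Q _) le_rfl rfl fun k => ?_)
      · simp_all
      · simp only [Function.update_apply]
        split_ifs <;> simp_all
    | cons b q =>
      refine Sem.bind_ret (a := some b) (Sem.to (sem_pop Q id) le_rfl ?_ fun _ => rfl)
        (Sem.to (sem_push Q b _) (by omega) rfl fun k => ?_)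
      · simp_all
      · simp only [Function.update_apply]
        split_ifs <;> simp_all
  | cons a e ih =>
    have hb : ∀ s', update (update s T (enc e ++ r)) T' (a :: true :: s T') = s' →
        Sem E (iter (cmpBody T T' Q Q') o) s (7 * (e.length + 1) + 6) (.ret (some (lexCmp o (a :: e) q),
          update (update (update (update s T r) T' ((enc (a :: e)).reverse ++ s T'))
            Q (q.drop (a :: e).length)) Q' ((q.take (a :: e).length).reverse ++ s Q'))) := by
      intro s' hs'
      have hQ₁ : s' Q = q := by rw [← hs']; simp [g₂, g₄, hQ]
      have hT₁ : s' T = enc e ++ r := by rw [← hs']; simp [h₁]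
      cases q with
      | nil =>
        refine Sem.mono (Sem.iter_inl (y := o.then .gt) (s' := s') (T := 1 + (1 + (1 + (1 + (1 + 2)))))
          (Sem.bind_ret (Sem.to (sem_pop T id) le_rfl (a' := some true) (by simp [hT])
            fun _ => rfl)
          (Sem.bind_ret (Sem.to (sem_pop T id) le_rfl (a' := some a) (by simp [hT]) fun _ => rfl)
          (Sem.bind_ret (sem_push T' true ()) (Sem.bind_ret (sem_push T' _ ())
          (Sem.bind_ret (Sem.to (sem_pop Q id) le_rfl (a' := none) (by simp [hQ, g₂, g₄])
            fun _ => rfl) (Sem.to (sem_pure Q _) le_rfl rfl fun k => ?_))))))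
          (Sem.to (ih (o.then .gt) hT₁ hQ₁) le_rfl rfl fun k => ?_)) (by omega)
        · rw [← hs']
          simp only [Function.update_apply]
          split_ifs <;> simp_all
        · rw [← hs']
          simp only [Function.update_apply]
          split_ifs <;> simp_all
      | cons b q =>
        have hQ₂ : update (update s' Q q) Q' (b :: s Q') Q = q := by simp [h₆]
        have hT₂ : update (update s' Q q) Q' (b :: s Q') T = enc e ++ r := by simp [h₂, h₃, hT₁]
        refine Sem.mono (Sem.iter_inl (y := o.then (compare a b))
          (s' := update (update s' Q q) Q' (b :: s Q')) (T := 1 + (1 + (1 + (1 + (1 + 1)))))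
          (Sem.bind_ret (Sem.to (sem_pop T id) le_rfl (a' := some true) (by simp [hT])
            fun _ => rfl)
          (Sem.bind_ret (Sem.to (sem_pop T id) le_rfl (a' := some a) (by simp [hT]) fun _ => rfl)
          (Sem.bind_ret (sem_push T' true ()) (Sem.bind_ret (sem_push T' _ ())
          (Sem.bind_ret (Sem.to (sem_pop Q id) le_rfl (a' := some b) (by simp [hQ, g₂, g₄])
            fun _ => rfl) (Sem.to (sem_push Q' b _) le_rfl rfl fun k => ?_))))))
          (Sem.to (ih (o.then (compare a b)) hT₂ hQ₂) le_rfl rfl fun k => ?_)) (by omega)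
        · rw [← hs']
          simp only [Function.update_apply]
          split_ifs <;> simp_all
        · rw [← hs']
          simp only [Function.update_apply]
          split_ifs <;> simp_all
    exact hb _ rfl

lemma sem_cmp {T T' Q Q' : K} (h : [T, T', Q, Q'].Nodup) {e r : Word}
    (hT : s T = enc e ++ r) (hQ' : s Q' = []) :
    Sem E (cmp T T' Q Q') s (7 * e.length + 2 * (s Q).length + 7)
      (.ret (some (lexCmp .eq e (s Q)),
        update (update s T r) T' ((enc e).reverse ++ s T'))) := by
  have hl := sem_iter_cmpBody (E := E) h .eq hT rfl
  simp at h
  refine Sem.mono (Sem.bind_ret hl (Sem.to (sem_move (by tauto) _) le_rfl rfl fun k => ?_)) ?_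
  · have : (s Q).take e.length ++ (s Q).drop e.length = s Q := List.take_append_drop _ _
    simp only [Function.update_apply]
    split_ifs <;> simp_all
  · simp only [Function.update_self, hQ', List.append_nil, List.length_reverse, List.length_take]
    omega

/-- What a comparison means for the search of a word in a list. -/
def lookupStep : Option Ordering → Unit ⊕ Bool
  | none => .inr false
  | some .eq => .inr true
  | some _ => .inl ()

/-- Is the word on `Q` in the list on `T`? The word is erased. -/
def lookup (T T' Q Q' : K) : Frag K Bool :=
  (iter (fun _ : Unit => (cmp T T' Q Q').map lookupStep) ()).bind fun r => (move T' T ()).bind fun _ => clear Q r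

-- The search stops at a hit or at the end of the list. Where it stops is irrelevant, hence the
-- existential: the scanned part `l₁` lies in reverse on `T'`, and moving it back restores the list.
open Classical in
lemma sem_iter_cmp {T T' Q Q' : K} (h : [T, T', Q, Q'].Nodup) {l : List Word} {m : ℕ}
    (hT : s T = encList l) (hQ' : s Q' = []) (hl : ∀ w ∈ l, w.length ≤ m) :
    ∃ l₁ l₂, l₁ ++ l₂ = l ∧ Sem E (iter (fun _ : Unit => (cmp T T' Q Q').map lookupStep) ()) s ((l.length + 1) * (7 * m + 2 * (s Q).length + 7))
      (.ret (decide (s Q ∈ l),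
        update (update s T (encList l₂)) T' ((encList l₁).reverse ++ s T'))) := by
  induction l generalizing s with
  | nil =>
    refine ⟨[], [], rfl, Sem.iter_inr (Sem.to ((sem_cmp_nil h hT hQ').map _) (by simp)
      (by simp [lookupStep]) fun k => ?_)⟩
    simp only [Function.update_apply]
    split_ifs <;> simp_all
  | cons e l ih =>
    have hc := sem_cmp (E := E) h (r := encList l) hT hQ'
    have he := hl e (by simp)
    have h' := h
    simp at h'
    by_cases heq : e = s Q
    · refine ⟨[e], l, rfl, Sem.iter_inr (Sem.to (hc.map _) ?_ ?_ fun k => ?_)⟩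
      · simp only [List.length_cons]
        nlinarith
      · simp [lexCmp_eq_iff.2 rfl, heq, lookupStep]
      · simp
    · have hQ : update (update s T (encList l)) T' ((enc e).reverse ++ s T') Q = s Q := by
        rw [Function.update_of_ne (by tauto), Function.update_of_ne (by tauto)]
      obtain ⟨l₁, l₂, hll, hs⟩ := ih (s := update (update s T (encList l)) T'
        ((enc e).reverse ++ s T')) (by simp [h'.1.1]) (by
          rw [Function.update_of_ne (by tauto), Function.update_of_ne (by tauto), hQ'])
        fun w hw => hl w (by simp [hw])
      rw [hQ] at hs
      refine ⟨e :: l₁, l₂, by simp [hll], Sem.mono (Sem.iter_inl (Sem.to (hc.map _) le_rfl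
        (a' := (.inl () : Unit ⊕ Bool)) ?_ fun k => rfl) (Sem.to hs le_rfl ?_ fun k => ?_)) ?_⟩
      · have := mt lexCmp_eq_iff.1 heq
        cases hcmp : lexCmp .eq e (s Q) <;> simp_all [lookupStep]
      · simp [Ne.symm heq]
      · simp only [Function.update_apply]
        split_ifs <;> simp_all
      · simp only [List.length_cons]
        nlinarith

open Classical in
lemma sem_lookup {T T' Q Q' : K} (h : [T, T', Q, Q'].Nodup) {l : List Word} {m : ℕ}
    (hT : s T = encList l) (hT' : s T' = []) (hQ' : s Q' = []) (hl : ∀ w ∈ l, w.length ≤ m) :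
    Sem E (lookup T T' Q Q') s ((l.length + 1) * (11 * m + 2 * (s Q).length + 9) +
        (s Q).length + 2)
      (.ret (decide (s Q ∈ l), update s Q [])) := by
  obtain ⟨l₁, l₂, rfl, hs⟩ := sem_iter_cmp (E := E) h hT hQ' hl
  simp at h
  refine Sem.mono (Sem.bind_ret hs (Sem.bind_ret (sem_move (by tauto) ()) (Sem.to (sem_clear Q _)
    le_rfl rfl fun k => ?_))) ?_
  · simp only [Function.update_apply]
    split_ifs <;> simp_all [encList_append]
  · have h₁ := length_encList_le (l := l₁) (m := m) fun w hw => hl w (by simp [hw])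
    have hQ : Q ≠ T ∧ Q ≠ T' := ⟨by tauto, by tauto⟩
    simp only [Function.update_self, hT', List.append_nil, List.length_reverse,
      Function.update_of_ne hQ.1, Function.update_of_ne hQ.2, List.length_append]
    nlinarith

end Frag

/-! ### Unary numbers and guessed words -/

/-- The number of leading `true`s. -/
def unaryVal : Word → ℕ
  | true :: w => unaryVal w + 1
  | _ => 0

/-- What follows the leading `true`s and a separator. -/
def unaryRest : Word → Word
  | true :: w => unaryRest w
  | false :: w => w
  | [] => []

@[simp] lemma unaryVal_replicate (n : ℕ) (w : Word) :
    unaryVal (List.replicate n true ++ false :: w) = n := by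
  induction n with
  | zero => rfl
  | succ n ih => simpa [List.replicate_succ, unaryVal] using ih

@[simp] lemma unaryRest_replicate (n : ℕ) (w : Word) :
    unaryRest (List.replicate n true ++ false :: w) = w := by
  induction n with
  | zero => rfl
  | succ n ih => simpa [List.replicate_succ, unaryRest] using ih

/-- This needs no well-formedness: the census machine must halt in polynomial time on every word,
not only on codes of questions. -/
lemma unary_length_le (w : Word) : unaryVal w + (unaryRest w).length ≤ w.length := by
  induction w with
  | nil => simp [unaryVal, unaryRest]
  | cons b w ih =>
    cases b
    · simp [unaryVal, unaryRest]
    · simp only [unaryVal, unaryRest, List.length_cons]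
      omega

/-- The tree of guesses of at most `n` symbols that are put in front of `w`. -/
def guessTree : ℕ → Word → Tr Word
  | 0, w => .ret w
  | n + 1, w => .node (.ret w) (.node (guessTree n (false :: w)) (guessTree n (true :: w)))

lemma exists_path_guessTree_iff {n : ℕ} {w v : Word} :
    (∃ g, (guessTree n w).Path g v) ↔ ∃ u : Word, v = u ++ w ∧ u.length ≤ n := by
  induction n generalizing w with
  | zero => simp [guessTree]
  | succ n ih =>
    constructor
    · rintro ⟨_ | ⟨_ | _, _ | ⟨b, g⟩⟩, hg⟩
      · simp [guessTree] at hg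
      · simp [guessTree] at hg
        exact ⟨[], by simp [hg]⟩
      · simp [guessTree] at hg
      · simp [guessTree] at hg
      · have : ∃ g, (guessTree n (b :: w)).Path g v := ⟨g, by cases b <;> simpa [guessTree] using hg⟩
        obtain ⟨u, rfl, hu⟩ := ih.1 this
        exact ⟨u ++ [b], by simp, by simpa using hu⟩
    · rintro ⟨u, rfl, hu⟩
      obtain rfl | ⟨u, b, rfl⟩ := u.eq_nil_or_concat'
      · exact ⟨[false], by simp [guessTree]⟩
      · obtain ⟨g, hg⟩ := (@ih (b :: w)).2 ⟨u, by simp, by simpa using hu⟩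
        exact ⟨true :: b :: g, by cases b <;> simpa [guessTree] using hg⟩

/-- Stopping yields `w`, while going on yields a longer word (`key`); the next symbol `b` remains
visible in the suffix `b :: w` (`key'`). -/
lemma inj_guessTree (n : ℕ) (w : Word) : (guessTree n w).Inj := by
  induction n generalizing w with
  | zero =>
    rintro g g' v ⟨rfl, -⟩ ⟨rfl, -⟩
    rfl
  | succ n ih =>
    have key (b : Bool) (g : List Bool) : ¬ (guessTree n (b :: w)).Path g w := fun h => by
      obtain ⟨u, hu, -⟩ := exists_path_guessTree_iff.1 ⟨g, h⟩
      have := congrArg List.length hu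
      simp at this
      omega
    have key' (g g' : List Bool) (v : Word) (h : (guessTree n (false :: w)).Path g v)
        (h' : (guessTree n (true :: w)).Path g' v) : False := by
      obtain ⟨u, rfl, -⟩ := exists_path_guessTree_iff.1 ⟨g, h⟩
      obtain ⟨u', hu, -⟩ := exists_path_guessTree_iff.1 ⟨g', h'⟩
      have := List.append_inj_right' hu (by simp)
      simp at this
    rintro (_ | ⟨_ | _, _ | ⟨b, g⟩⟩) (_ | ⟨_ | _, _ | ⟨b', g'⟩⟩) v h h' <;>
      simp [guessTree] at h h' ⊢
    · subst h
      cases b' <;> simp [key] at h'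
    · subst h'
      cases b <;> simp [key] at h
    · cases b <;> cases b' <;> simp at h h' ⊢
      · exact ih _ _ _ _ h h'
      · exact key' _ _ _ h h'
      · exact key' _ _ _ h' h
      · exact ih _ _ _ _ h h'

namespace Frag

variable {K α : Type} [DecidableEq K] {E : Env K} {s : Store K}

/-- Read a number in unary, and the separator behind it. -/
def unary (src dst : K) : Frag K Unit :=
  iter (fun _ : Unit => (pop src id).bind fun
    | some true => push dst true (.inl ())
    | _ => pure src (.inr ())) ()

lemma sem_unary {src dst : K} (h : src ≠ dst) :
    Sem E (unary src dst) s (2 * (s src).length + 3) (.ret ((), update (update s src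
      (unaryRest (s src))) dst (List.replicate (unaryVal (s src)) true ++ s dst))) := by
  generalize hw : s src = w
  have h' := h.symm
  induction w generalizing s with
  | nil =>
    refine Sem.mono (T := 1 + 2) (Sem.iter_inr (Sem.bind_ret (Sem.to (sem_pop src id) le_rfl
      (a' := none) (by simp [hw]) fun _ => rfl) (Sem.to (sem_pure src _) le_rfl rfl
      fun k => ?_))) (by simp)
    simp only [Function.update_apply, unaryRest, unaryVal]
    split_ifs <;> simp_all
  | cons b w ih =>
    cases b with
    | false =>
      refine Sem.mono (T := 1 + 2) (Sem.iter_inr (Sem.bind_ret (Sem.to (sem_pop src id) le_rfl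
        (a' := some false) (by simp [hw])
        fun _ => rfl) (Sem.to (sem_pure src _) le_rfl rfl fun k => ?_))) (by omega)
      simp only [Function.update_apply, unaryRest, unaryVal]
      split_ifs <;> simp_all
    | true =>
      have := ih (s := update (update s src w) dst (true :: s dst)) (by simp [h])
      refine Sem.mono (Sem.iter_inl (T := 1 + 1) (s' := update (update s src w) dst (true :: s dst))
        (Sem.bind_ret (Sem.to (sem_pop src id) le_rfl (a' := some true) (by simp [hw])
        fun _ => rfl) (Sem.to (sem_push dst true _) le_rfl rfl fun k => ?_))
        (Sem.to this le_rfl rfl fun k => ?_)) (by simp; omega)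
      · simp only [Function.update_apply]
        split_ifs <;> simp_all
      · simp only [Function.update_apply, unaryRest, unaryVal, List.replicate_succ',
          List.append_assoc]
        split_ifs <;> simp_all

/-- Move the code of the word on `C` to `T`. -/
def pushWord (C C' T : K) (a : α) : Frag K α :=
  (move C C' ()).bind fun _ => (push T false ()).bind fun _ =>
    iter (fun _ : Unit => (pop C' id).bind fun
      | none => pure C' (.inr a)
      | some b => (push T b ()).bind fun _ => push T true (.inl ())) ()

lemma sem_pushWord {C C' T : K} (h₁ : C ≠ C') (h₂ : C ≠ T) (h₃ : C' ≠ T) (a : α)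
    (hC' : s C' = []) :
    Sem E (pushWord C C' T a) s (5 * (s C).length + 5)
      (.ret (a, update (update s C []) T (enc (s C) ++ s T))) := by
  have g₁ := h₁.symm
  have g₂ := h₂.symm
  have g₃ := h₃.symm
  have hloop (w : Word) : ∀ s : Store K, s C' = w → Sem E
      (iter (fun _ : Unit => (pop C' id).bind fun
        | none => pure C' (.inr a)
        | some b => (push T b ()).bind fun _ => push T true (.inl ())) ()) s (3 * w.length + 3)
      (.ret (a, update (update s C' []) T (w.reverse.flatMap (fun b => [true, b]) ++ s T))) := by
    induction w with
    | nil =>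
      intro s hw
      refine Sem.mono (T := 1 + 2) (Sem.iter_inr (Sem.bind_ret (Sem.to (sem_pop C' id) le_rfl
        (a' := none) (by simp [hw]) fun _ => rfl) (Sem.to (sem_pure C' _) le_rfl rfl
        fun k => ?_))) (by simp)
      simp only [Function.update_apply]
      split_ifs <;> simp_all
    | cons b w ih =>
      intro s hw
      have := ih (update (update s C' w) T (true :: b :: s T)) (by simp [h₃])
      refine Sem.mono (Sem.iter_inl (T := 1 + (1 + 1)) (s' := update (update s C' w) T
        (true :: b :: s T)) (Sem.bind_ret (Sem.to (sem_pop C' id) le_rfl (a' := some b)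
        (by simp [hw]) fun _ => rfl) (Sem.bind_ret (sem_push T b ())
        (Sem.to (sem_push T true _) le_rfl rfl fun k => ?_)))
        (Sem.to this le_rfl rfl fun k => ?_)) (by simp; omega)
      · simp only [Function.update_apply]
        split_ifs <;> simp_all
      · simp only [Function.update_apply]
        split_ifs <;> simp_all
  refine Sem.mono (Sem.bind_ret (sem_move h₁ ()) (Sem.bind_ret (sem_push T false ())
    (Sem.to (hloop (s C).reverse _ ?_) le_rfl rfl fun k => ?_))) ?_
  · simp [h₃, hC']
  · simp only [Function.update_apply, enc, List.append_assoc]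
    split_ifs <;> simp_all
  · simp
    omega

/-- Guess a word on `C`; the stack `B` bounds its length. -/
def guessWord (B B' C : K) : Frag K Unit :=
  (iter (fun _ : Unit => (pop B id).bind fun
    | none => pure B (.inr ())
    | some b => (push B' b ()).bind fun _ => (guess id).bind fun
      | false => move B B' (.inr ())
      | true => (guess id).bind fun c => push C c (.inl ())) ()).bind fun _ => move B' B ()

/-- Every path, also one that stops early, moves all of `B` to `B'` before `B` is restored. The
final store therefore depends on the guessed word alone. -/
lemma sem_guessWord {B B' C : K} (h₁ : B ≠ B') (h₂ : B ≠ C) (h₃ : B' ≠ C) (hB' : s B' = []) :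
    Sem E (guessWord B B' C) s (((s B).length + 1) * (2 * (s B).length + 8))
      ((guessTree (s B).length (s C)).map fun w => ((), update s C w)) := by
  have g₁ := h₁.symm
  have g₂ := h₂.symm
  have g₃ := h₃.symm
  have hloop (u : Word) : ∀ s : Store K, s B = u → Sem E
      (iter (fun _ : Unit => (pop B id).bind fun
        | none => pure B (.inr ())
        | some b => (push B' b ()).bind fun _ => (guess id).bind fun
          | false => move B B' (.inr ())
          | true => (guess id).bind fun c => push C c (.inl ())) ()) s ((u.length + 1) * (2 * u.length + 6))
      ((guessTree u.length (s C)).map fun w =>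
        ((), update (update (update s B []) B' (u.reverse ++ s B')) C w)) := by
    induction u with
    | nil =>
      intro s hw
      refine Sem.mono (T := 1 + 2) (Sem.iter_inr (Sem.bind_ret (Sem.to (sem_pop B id) le_rfl
        (a' := none) (by simp [hw]) fun _ => rfl) (Sem.to (sem_pure B _) le_rfl rfl
        fun k => ?_))) (by simp)
      simp only [Function.update_apply]
      split_ifs <;> simp_all
    | cons b u ih =>
      intro s hw
      set s₁ := update (update s B u) B' (b :: s B') with hs₁
      have hB : s₁ B = u := by simp [hs₁, h₁]
      have hC : s₁ C = s C := by simp [hs₁, g₂, g₃]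
      -- One round is indexed by `Option Bool`: `none` is the decision to stop, `some c` the guess
      -- of the symbol `c`.
      have hbody : Sem E ((pop B id).bind fun
          | none => pure B (.inr ())
          | some b => (push B' b ()).bind fun _ => (guess id).bind fun
            | false => move B B' (.inr ())
            | true => (guess id).bind fun c => push C c (.inl ())) s
            (1 + (1 + (1 + (2 * u.length + 2))))
          ((Tr.node (.ret none) (.node (.ret (some false)) (.ret (some true)))).map fun o =>
            (o.elim (Sum.inr ()) fun _ => Sum.inl (), o.elim (update (update s₁ B []) B' (u.reverse ++ s₁ B'))
              fun c => update s₁ C (c :: s C))) := by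
        refine Sem.bind_ret (Sem.to (sem_pop B id) le_rfl (a' := some b) (by simp [hw])
          fun _ => rfl) (Sem.bind_ret (Sem.to (s'' := s₁) (sem_push B' b ()) le_rfl rfl fun k => ?_)
            (Sem.guess_bind ?_ (Sem.mono (T := 1 + 1) (Sem.guess_bind ?_ ?_) (by omega))))
        · simp only [hs₁, Function.update_apply]
          split_ifs <;> simp_all
        · exact Sem.to (sem_move h₁ _) (by rw [hB]; omega) rfl (by simp [hB])
        · exact Sem.to (sem_push C _ _) le_rfl rfl (by simp [hC])
        · exact Sem.to (sem_push C _ _) le_rfl rfl (by simp [hC])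
      have hrec (c : Bool) := ih (update s₁ C (c :: s C)) (by simp [h₂, hB])
      simp only [Function.update_self] at hrec
      refine (Sem.iter_map hbody (T' := (u.length + 1) * (2 * u.length + 6)) (f := fun o => o.elim
        (.ret ((), update (update s₁ B []) B' (u.reverse ++ s₁ B'))) fun c =>
        (guessTree u.length (c :: s C)).map fun w =>
          ((), update (update (update (update s₁ C (c :: s C)) B []) B'
            (u.reverse ++ update s₁ C (c :: s C) B')) C w)) ?_ ?_).congr ?_ ?_
      · rintro g (_ | c) y - hy
        · simp at hy
        · exact hrec c
      · rintro g (_ | c) y - hy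
        · rfl
        · simp at hy
      · simp only [List.length_cons]
        linarith
      · have hst (c : Bool) (w : Word) : update (update (update (update s₁ C (c :: s C)) B []) B'
            (u.reverse ++ update s₁ C (c :: s C) B')) C w =
            update (update (update s B []) B' ((b :: u).reverse ++ s B')) C w := by
          funext k
          simp only [hs₁, Function.update_apply]
          split_ifs <;> simp_all
        have hst' : update (update s₁ B []) B' (u.reverse ++ s₁ B') =
            update (update (update s B []) B' ((b :: u).reverse ++ s B')) C (s C) := by
          funext k
          simp only [hs₁, Function.update_apply]
          split_ifs <;> simp_all
        simp only [Tr.bind_node, Tr.bind_ret, Option.elim_none, Option.elim_some, hst, hst',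
          List.length_cons, guessTree, Tr.map_node, Tr.map_ret]
  refine ((hloop _ s rfl).bind_map (T' := 2 * (s B).length + 1)
    (f := fun w => .ret ((), update s C w)) fun g w _ => ?_).congr (by linarith) rfl
  refine Sem.to (sem_move g₁ ()) ?_ rfl fun k => ?_
  · simp [h₃, hB']
  · simp only [Function.update_apply]
    split_ifs <;> simp_all

end Frag

/-! ### The census machine -/

/-- May the word be put in front of the strictly decreasing list? -/
def OkNext : List Word → Word → Prop
  | [], _ => True
  | e :: _, c => e < c

open Classical in
/-- Guess `n` words of length at most `m` that `R` accepts, in increasing order, and put them in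
front of `l`. -/
noncomputable def guessList (R : Word → Tr Bool) (m : ℕ) : ℕ → List Word → Tr (List Word)
  | 0, l => .ret l
  | n + 1, l => (guessTree m []).bind fun c =>
      if OkNext l c then (R c).bind fun b => if b then guessList R m n (c :: l) else .fail
      else .fail

namespace Frag

lemma extend_comp_self {K γ ι : Type} (e : ι → K) (he : Function.Injective e) (s : K → γ)
    {f : ι → γ} (hf : ∀ k, s (e k) = f k) : extend e f s = s := by
  funext k
  by_cases hk : ∃ j, e j = k
  · obtain ⟨j, rfl⟩ := hk
    rw [he.extend_apply, hf]
  · rw [Function.extend_apply' _ _ _ hk]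

section call

variable {K α : Type} [DecidableEq K] {E : Env K} {s : Store K} {N : OracleTM} {e : N.K → K}
  {h : Frag K Bool} {B : Lang} {H : ℕ}

open Classical in
/-- Calling an embedded machine whose stacks are empty. -/
lemma sem_call (he : Function.Injective e) {p : Polynomial ℕ} (hp : N.TimeBound p) (x : Word)
    (hs : ∀ k, s (e k) = [])
    (hh : ∀ stk : Store N.K, stk N.queryStack ∈ N.queries B x → Sem E h (extend e stk s) H
      (.ret (decide (stk N.queryStack ∈ B), extend e (update stk N.queryStack []) s))) :
    Sem E (exec N e h N.start) (update s (e N.input) x)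
      ((p.eval x.length + 1) * (H + 1) + (N.keys.length + 1) * (x.length + p.eval x.length + 1))
      ((N.run p B x).map fun b => (b, s)) := by
  have := sem_exec_start he hp x hh
  rwa [extend_comp_self e he s hs, ← update_extend he, extend_comp_self e he s hs] at this

end call

section census

variable (N V : OracleTM)

/-- The stacks of the census machine: those of `N`, those of `V`, and auxiliary stacks, which hold
0: the input, 1: a counter, 2: the length bound, 4: a list of words, 6: a word;
3, 5 and 7 are scratch stacks. -/
abbrev CensusK : Type := N.K ⊕ V.K ⊕ Fin 8

variable {N V}

abbrev aux (i : Fin 8) : CensusK N V := .inr (.inr i)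
abbrev emb (k : V.K) : CensusK N V := .inr (.inl k)

/-- Is the word on stack 6 a permitted continuation of the list on stack 4? -/
def isNext : Frag (CensusK N V) Bool :=
  (cmp (aux 4) (aux 5) (aux 6) (aux 7)).bind fun r =>
    move (aux 5) (aux 4) (r == none || r == some .lt)

variable {E : Env (CensusK N V)} {s : Store (CensusK N V)}

lemma nodup_aux : [(aux 4 : CensusK N V), aux 5, aux 6, aux 7].Nodup := by
  simp

-- The list is built to be decreasing, so its head is its largest word and one comparison is enough.
-- The result `none` stands for the empty list.
open Classical in
lemma sem_isNext {l : List Word} {m : ℕ} (h₄ : s (aux 4) = encList l) (h₅ : s (aux 5) = [])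
    (h₇ : s (aux 7) = []) (hl : ∀ w ∈ l, w.length ≤ m) :
    Sem E isNext s (11 * m + 2 * (s (aux 6)).length + 10)
      (.ret (decide (OkNext l (s (aux 6))), s)) := by
  cases l with
  | nil =>
    refine Sem.mono (Sem.bind_ret (sem_cmp_nil nodup_aux h₄ h₇) (Sem.to (T' := 1)
      (sem_move (by simp) _) (by simp [h₅])
      (decide_eq_true (p := OkNext [] _) trivial).symm fun k => ?_)) (by omega)
    simp only [Function.update_apply]
    split_ifs <;> simp_all
  | cons e l =>
    have he := hl e (by simp)
    refine Sem.mono (Sem.bind_ret (sem_cmp nodup_aux (r := encList l) h₄ h₇)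
      (Sem.to (sem_move (by simp) _) le_rfl ?_ fun k => ?_)) ?_
    · rw [Bool.eq_iff_iff, decide_eq_true_iff]
      simp [OkNext, lexCmp_lt_iff]
    · simp only [Function.update_apply]
      split_ifs <;> simp_all
    · simp [h₅]
      omega

/-- Verify the word on stack 6 and add it to the list on stack 4. -/
noncomputable def verify : Frag (CensusK N V) (Unit ⊕ Unit) :=
  (copy (aux 6) (aux 7) (emb V.input) id ()).bind fun _ =>
    (exec V emb (clear (emb V.queryStack) false) V.start).bind fun
      | true => pushWord (aux 6) (aux 7) (aux 4) (.inl ())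
      | false => reject

/-- The summands pay for copying the word, running `V` with a query of at most m + p(m) symbols
erased at each query step, clearing the stacks of `V`, and coding the word. -/
noncomputable def verifyTime (p : Polynomial ℕ) (m : ℕ) : ℕ :=
  5 * m + 2 + ((p.eval m + 1) * (m + p.eval m + 2) + (V.keys.length + 1) * (m + p.eval m + 1) +
    (5 * m + 5))

lemma emb_injective : Function.Injective (emb : V.K → CensusK N V) := fun a b h => by
  simpa using h

/-- `V` works with the empty oracle, so erasing the query and answering `false` is a correct query
handler. -/
lemma sem_verify {p : Polynomial ℕ} (hV : V.TimeBound p) {l : List Word} {m : ℕ}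
    (h₄ : s (aux 4) = encList l) (h₇ : s (aux 7) = []) (hs : ∀ k, s (emb k) = [])
    (h₆ : (s (aux 6)).length ≤ m) :
    Sem E verify s (verifyTime (V := V) p m) ((V.run p ∅ (s (aux 6))).bind fun b =>
      if b then .ret (.inl (), update (update s (aux 6) []) (aux 4) (encList (s (aux 6) :: l)))
      else .fail) := by
  classical
  set c := s (aux 6) with hc
  have hp := eval_mono p h₆
  have hcall := sem_call (E := E) (s := s) (B := ∅) (H := m + p.eval m + 1)
    (h := clear (emb V.queryStack) false) emb_injective hV c hs fun stk hq => by
      have hlen := hV.length_query_le hq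
      refine Sem.to (sem_clear _ _) ?_ (by simp) fun k => ?_
      · rw [emb_injective.extend_apply]
        omega
      · rw [update_extend emb_injective]
  refine Sem.mono (T := 5 * m + 2 + (_ + (5 * m + 5))) (Sem.bind_ret (s' := update s (emb V.input) c)
    (Sem.to (sem_copy (by simp) (by simp) (by simp) _ _ h₇) (by rw [← hc]; omega) rfl fun k => ?_)
    (Sem.bind_map hcall fun g b _ => ?_)) ?_
  · simp [hs, ← hc]
  · cases b with
    | false => exact Sem.mono sem_reject (by simp)
    | true =>
      refine Sem.to (sem_pushWord (by simp) (by simp) (by simp) _ h₇) (by simp only [← hc]; omega) rfl fun k => ?_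
      simp [h₄, ← hc]
  · unfold verifyTime
    gcongr

/-- Guess the words, as many as the counter says. -/
noncomputable def gatherBody : Frag (CensusK N V) (Unit ⊕ Unit) :=
  (pop (aux 1) id).bind fun
    | some true => (guessWord (aux 2) (aux 3) (aux 6)).bind fun _ => isNext.bind fun
      | true => verify
      | false => reject
    | _ => pure (aux 1) (.inr ())

noncomputable def gather : Frag (CensusK N V) Unit :=
  iter (fun _ : Unit => gatherBody) ()

noncomputable def gatherTime (p : Polynomial ℕ) (m : ℕ) : ℕ :=
  1 + ((m + 1) * (2 * m + 8) + ((13 * m + 10) + verifyTime (V := V) p m))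

/-- The auxiliary stacks before a round of guessing; the stack 4 holds the list `l`. -/
structure GatherReady (s : Store (CensusK N V)) (l : List Word) : Prop where
  h₃ : s (aux 3) = []
  h₄ : s (aux 4) = encList l
  h₅ : s (aux 5) = []
  h₆ : s (aux 6) = []
  h₇ : s (aux 7) = []
  hV : ∀ k, s (emb k) = []

open Classical in
lemma sem_gatherBody {p : Polynomial ℕ} (hV : V.TimeBound p) {l : List Word} {m n : ℕ}
    (h : GatherReady s l) (h₁ : s (aux 1) = List.replicate (n + 1) true)
    (h₂ : (s (aux 2)).length = m) (hl : ∀ w ∈ l, w.length ≤ m) :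
    Sem E gatherBody s (gatherTime (V := V) p m) (((guessTree m []).bind fun c =>
      if OkNext l c then (V.run p ∅ c).bind fun b => if b then .ret (c :: l) else .fail
      else .fail).map fun l' => (.inl (),
        update (update s (aux 1) (List.replicate n true)) (aux 4) (encList l'))) := by
  set s₁ := update s (aux 1) (List.replicate n true) with hs₁
  have hg := sem_guessWord (E := E) (s := s₁) (B := aux 2) (B' := aux 3) (C := aux 6) (by simp)
    (by simp) (by simp) (by simp [hs₁, h.h₃])
  have e₁ : s₁ (aux 2) = s (aux 2) := by simp [hs₁]
  have e₂ : s₁ (aux 6) = [] := by simp [hs₁, h.h₆]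
  rw [e₁, e₂, h₂] at hg
  rw [Tr.map_bind]
  refine Sem.bind_ret (a := some true) (s' := s₁) (Sem.to (sem_pop _ id) le_rfl
    (by simp [h₁, List.replicate_succ]) (by simp [h₁, List.replicate_succ, hs₁])) ?_
  refine Sem.bind_map hg fun g c hp => ?_
  obtain ⟨u, hu, hum⟩ := exists_path_guessTree_iff.1 ⟨g, hp⟩
  have hcm : c.length ≤ m := by simpa [hu] using hum
  have hn := sem_isNext (E := E) (s := update s₁ (aux 6) c) (l := l) (m := m) (by simp [hs₁, h.h₄])
    (by simp [hs₁, h.h₅]) (by simp [hs₁, h.h₇]) hl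
  simp only [Function.update_self] at hn
  refine Sem.bind_ret (Sem.to hn (by omega) rfl fun _ => rfl) ?_
  by_cases hok : OkNext l c
  · have hv := sem_verify (E := E) (s := update s₁ (aux 6) c) (l := l) (m := m) hV
      (by simp [hs₁, h.h₄]) (by simp [hs₁, h.h₇]) (by simp [hs₁, h.hV]) (by simpa using hcm)
    simp only [Function.update_self] at hv
    rw [decide_eq_true hok, if_pos hok, Tr.map_bind]
    refine Sem.congr hv le_rfl ?_
    congr 1
    funext b
    cases b
    · rfl
    · simp only [if_true, Tr.map_ret]
      congr 2
      funext k
      have := h.h₆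
      simp only [hs₁, Function.update_apply]
      split_ifs <;> simp_all
  · rw [decide_eq_false hok, if_neg hok]
    exact Sem.mono sem_reject (Nat.zero_le _)

lemma sem_gather {p : Polynomial ℕ} (hV : V.TimeBound p) {l : List Word} {m n : ℕ}
    (h : GatherReady s l) (h₁ : s (aux 1) = List.replicate n true)
    (h₂ : (s (aux 2)).length = m) (hl : ∀ w ∈ l, w.length ≤ m) :
    Sem E gather s (n * gatherTime (V := V) p m + 3)
      ((guessList (V.run p ∅) m n l).map fun l' =>
        ((), update (update s (aux 1) []) (aux 4) (encList l'))) := by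
  classical
  induction n generalizing s l with
  | zero =>
    refine Sem.mono (T := 1 + 2) (Sem.iter_inr (Sem.bind_ret (a := none) (Sem.to (sem_pop _ id)
      le_rfl (by simp [h₁]) fun _ => rfl) (Sem.to (sem_pure _ _) le_rfl rfl fun k => ?_))) (by omega)
    have := h.h₄
    simp only [Function.update_apply]
    split_ifs <;> simp_all
  | succ n ih =>
    refine (Sem.iter_map (sem_gatherBody hV h h₁ h₂ hl) (T' := n * gatherTime (V := V) p m + 3)
      (f := fun l' => (guessList (V.run p ∅) m n l').map fun l'' =>
        ((), update (update s (aux 1) []) (aux 4) (encList l''))) ?_ ?_).congr (by linarith) ?_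
    · intro g l' _ hp _
      have hl' : ∀ w ∈ l', w.length ≤ m := by
        obtain ⟨g₁, g₂, c, -, hc, hp⟩ := Tr.path_bind.1 hp
        obtain ⟨u, hu, hum⟩ := exists_path_guessTree_iff.1 ⟨_, hc⟩
        split_ifs at hp
        · obtain ⟨g₃, g₄, b, -, -, hp⟩ := Tr.path_bind.1 hp
          cases b
          · exact hp.elim
          · obtain ⟨-, rfl⟩ := hp
            simpa [hu, hum] using hl
        · exact hp.elim
      set s' := update (update s (aux 1) (List.replicate n true)) (aux 4) (encList l') with hs'
      have hr : GatherReady s' l' := by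
        constructor <;> simp [hs', h.h₃, h.h₅, h.h₆, h.h₇, h.hV]
      refine Sem.congr (ih hr (by simp [hs']) (by simp [hs', h₂]) hl') le_rfl ?_
      congr 1
      funext l''
      congr 1
      funext k
      simp only [hs', Function.update_apply]
      split_ifs <;> simp_all
    · intro g l' _ _ hy
      simp at hy
    · simp only [guessList, Tr.bind_assoc, Tr.map_bind]
      congr 1
      funext c
      split_ifs
      · simp only [Tr.bind_assoc, Tr.map_bind]
        congr 1
        funext b
        cases b <;> simp
      · rfl

end census

end Frag

namespace Frag

variable {N V : OracleTM} {p q : Polynomial ℕ}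

variable (N V) in
/-- On a word that consists of a flag, two unary numbers `k` and `m`, and a word `x`: guess, in
increasing order, `k` words of length at most `m` in the language of `V`; then, if the flag is set,
run `N` on `x` with the set of these words as the oracle. -/
noncomputable def census : Frag (CensusK N V) Bool :=
  (pop (aux 0) id).bind fun fl => (unary (aux 0) (aux 1)).bind fun _ =>
    (unary (aux 0) (aux 2)).bind fun _ => gather.bind fun _ => match fl with
      | some true => (move (aux 0) (aux 3) ()).bind fun _ =>
        (move (aux 3) (.inl N.input) ()).bind fun _ =>
          exec N .inl (lookup (aux 4) (aux 5) (.inl N.queryStack) (aux 7)) N.start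
      | _ => pure (aux 0) true

/-- The tree of the last phase of the census machine. -/
noncomputable def finishTree (N : OracleTM) (p : Polynomial ℕ) (fl : Option Bool) (x : Word)
    (l : List Word) : Tr Bool :=
  if fl = some true then N.run p {w | w ∈ l} x else .ret true

lemma length_of_path_guessList {R : Word → Tr Bool} {m n : ℕ} {l l' : List Word} {g : List Bool}
    (h : (guessList R m n l).Path g l') :
    l'.length = n + l.length ∧ ((∀ w ∈ l, w.length ≤ m) → ∀ w ∈ l', w.length ≤ m) := by
  classical
  induction n generalizing l g with
  | zero =>
    obtain ⟨-, rfl⟩ := h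
    simp
  | succ n ih =>
    obtain ⟨g₁, g₂, c, -, hc, hp⟩ := Tr.path_bind.1 h
    obtain ⟨u, hu, hum⟩ := exists_path_guessTree_iff.1 ⟨_, hc⟩
    split_ifs at hp
    · obtain ⟨g₃, g₄, b, -, -, hp⟩ := Tr.path_bind.1 hp
      cases b
      · exact hp.elim
      · have := ih hp
        rw [List.length_cons] at this
        refine ⟨by omega, fun hl => this.2 ?_⟩
        simpa [hu, hum] using hl
    · exact hp.elim

/-- The inner bound is the time of a lookup in a list of at most n words of length at most n, for a
query of at most n + p(n) symbols. -/
noncomputable def finishTime (N : OracleTM) (p : Polynomial ℕ) (n : ℕ) : ℕ :=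
  (p.eval n + 1) * ((n + 1) * (11 * n + 2 * (n + p.eval n) + 9) + (n + p.eval n) + 2 + 1) +
    (N.keys.length + 1) * (n + p.eval n + 1)

variable {E : Env (CensusK N V)} {s : Store (CensusK N V)}

lemma sem_finish (hN : N.TimeBound p) {l : List Word} {n : ℕ} (fl : Option Bool)
    (h₀ : (s (aux 0)).length ≤ n) (h₃ : s (aux 3) = [])
    (h₄ : s (aux 4) = encList l) (h₅ : s (aux 5) = [])
    (h₇ : s (aux 7) = []) (hs : ∀ k, s (.inl k) = []) (hl : ∀ w ∈ l, w.length ≤ n)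
    (hln : l.length ≤ n) :
    Sem E (match fl with
      | some true => (move (aux 0) (aux 3) ()).bind fun _ =>
        (move (aux 3) (.inl N.input) ()).bind fun _ =>
          exec N .inl (lookup (aux 4) (aux 5) (.inl N.queryStack) (aux 7)) N.start
      | _ => pure (aux 0) true) s (2 * n + 1 + (2 * n + 1 + finishTime N p n))
      ((finishTree N p fl (s (aux 0)) l).map fun b =>
        (b, if fl = some true then update s (aux 0) [] else s)) := by
  classical
  have hnot (h : fl ≠ some true) : Sem E (match fl with
      | some true => (move (aux 0) (aux 3) ()).bind fun _ =>
        (move (aux 3) (.inl N.input) ()).bind fun _ =>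
          exec N .inl (lookup (aux 4) (aux 5) (.inl N.queryStack) (aux 7)) N.start
      | _ => pure (aux 0) true) s (2 * n + 1 + (2 * n + 1 + finishTime N p n))
      ((finishTree N p fl (s (aux 0)) l).map fun b =>
        (b, if fl = some true then update s (aux 0) [] else s)) := by
    rw [finishTree, if_neg h, if_neg h]
    rcases fl with _ | _ | _
    · exact Sem.mono (sem_pure _ _) (by omega)
    · exact Sem.mono (sem_pure _ _) (by omega)
    · exact absurd rfl h
  by_cases hfl : fl = some true
  · subst hfl
    set x := s (aux 0) with hx
    set s₁ := update s (aux 0) [] with hs₁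
    have hpn := eval_mono p h₀
    have hcall := sem_call (E := E) (s := s₁) (B := {w | w ∈ l}) (e := Sum.inl)
      (H := (n + 1) * (11 * n + 2 * (n + p.eval n) + 9) + (n + p.eval n) + 2)
      (h := lookup (aux 4) (aux 5) (.inl N.queryStack) (aux 7)) Sum.inl_injective hN x
      (by simp [hs₁, hs]) fun stk hq => by
        have hlen := hN.length_query_le hq
        have hq : extend (Sum.inl : N.K → CensusK N V) stk s₁ (.inl N.queryStack) =
          stk N.queryStack := Sum.inl_injective.extend_apply _ _ _
        refine Sem.to (sem_lookup (l := l) (m := n) (by simp) (by simp [hs₁, h₄])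
          (by simp [hs₁, h₅]) (by simp [hs₁, h₇]) hl) ?_ ?_ fun k => ?_
        · rw [hq]
          gcongr <;> omega
        · rw [hq]
          exact decide_eq_decide.2 Iff.rfl
        · rw [update_extend Sum.inl_injective]
    refine (Sem.bind_ret (sem_move (by simp) ()) (Sem.bind_ret (s' := update s₁ (.inl N.input) x)
      (Sem.to (sem_move (by simp) ()) le_rfl rfl fun k => ?_) hcall)).congr ?_ ?_
    · have := hs N.input
      simp only [hs₁, Function.update_apply]
      split_ifs <;> simp_all
    · simp only [Function.update_self, h₃, List.append_nil, List.length_reverse, ← hx, finishTime]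
      gcongr
    · simp [finishTree]
  · exact hnot hfl

noncomputable def censusTime (N V : OracleTM) (p q : Polynomial ℕ) (n : ℕ) : ℕ :=
  1 + (2 * n + 3 + (2 * n + 3 + (n * gatherTime (V := V) q n + 3 +
    (2 * n + 1 + (2 * n + 1 + finishTime N p n)))))

lemma gatherTime_mono {m n : ℕ} (h : m ≤ n) :
    gatherTime (V := V) q m ≤ gatherTime (V := V) q n := by
  have := eval_mono q h
  unfold gatherTime verifyTime
  gcongr

lemma exists_polynomial_censusTime (N V : OracleTM) (p q : Polynomial ℕ) :
    ∃ P : Polynomial ℕ, ∀ n, P.eval n = censusTime N V p q n := by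
  let v : Polynomial ℕ := 5 * .X + 2 + ((q + 1) * (.X + q + 2) +
    .C (V.keys.length + 1) * (.X + q + 1) + (5 * .X + 5))
  let g : Polynomial ℕ := 1 + ((.X + 1) * (2 * .X + 8) + ((13 * .X + 10) + v))
  let f : Polynomial ℕ :=
    (p + 1) * ((.X + 1) * (11 * .X + 2 * (.X + p) + 9) + (.X + p) + 2 + 1) +
      .C (N.keys.length + 1) * (.X + p + 1)
  refine ⟨1 + (2 * .X + 3 + (2 * .X + 3 + (.X * g + 3 + (2 * .X + 1 + (2 * .X + 1 + f))))),
    fun n => ?_⟩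
  simp [censusTime, finishTime, gatherTime, verifyTime, v, g, f]

/-- Both numbers are written in unary, so they are at most the length of `y` and all bounds become
polynomial in that length. The final store `σ l` plays no role for acceptance and is left
unspecified. -/
lemma sem_census (hN : N.TimeBound p) (hV : V.TimeBound q) (y : Word) :
    ∃ σ : List Word → Store (CensusK N V),
    Sem E (census N V) (update (fun _ => []) (aux 0) y) (censusTime N V p q y.length)
      ((guessList (V.run q ∅) (unaryVal (unaryRest y.tail)) (unaryVal y.tail) []).bind fun l =>
        (finishTree N p y.head? (unaryRest (unaryRest y.tail)) l).map fun b => (b, σ l)) := by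
  set y₁ := y.tail with hy₁
  set k := unaryVal y₁ with hk
  set y₂ := unaryRest y₁ with hy₂
  set m := unaryVal y₂ with hm
  set x := unaryRest y₂ with hx
  have l₁ : y₁.length ≤ y.length := by simp [hy₁]
  have l₂ : k + y₂.length ≤ y₁.length := unary_length_le y₁
  have l₃ : m + x.length ≤ y₂.length := unary_length_le y₂
  set s₃ : Store (CensusK N V) := update (update (update (fun _ => []) (aux 0) x) (aux 1)
    (List.replicate k true)) (aux 2) (List.replicate m true) with hs₃
  have hready : GatherReady s₃ [] := by
    constructor <;> simp [hs₃]
  have hgather := sem_gather (E := E) hV (n := k) (m := m) hready (by simp [hs₃]) (by simp [hs₃])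
    (by simp)
  have hg := Nat.mul_le_mul (show k ≤ y.length by omega)
    (gatherTime_mono (V := V) (q := q) (show m ≤ y.length by omega))
  refine ⟨fun l => if y.head? = some true then
    update (update (update s₃ (aux 1) []) (aux 4) (encList l)) (aux 0) []
    else update (update s₃ (aux 1) []) (aux 4) (encList l), Sem.mono (Sem.bind_ret (T := 1) (a := y.head?)
    (s' := update (fun _ => []) (aux 0) y₁)
    (Sem.to (sem_pop _ id) le_rfl (by simp) (by simp [hy₁])) (Sem.bind_ret
      (s' := update (update (fun _ => []) (aux 0) y₂) (aux 1) (List.replicate k true))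
      (T := 2 * y.length + 3) (Sem.to (sem_unary (by simp)) (by simpa using l₁) rfl fun j => ?_)
      (Sem.bind_ret (s' := s₃) (T := 2 * y.length + 3) (Sem.to (sem_unary (by simp)) ?_ rfl fun j => ?_)
      (Sem.bind_map hgather fun g l hl => ?_)))) (T := 1 + (2 * y.length + 3 + (2 * y.length + 3 +
        (k * gatherTime (V := V) q m + 3 + (2 * y.length + 1 + (2 * y.length + 1 +
        finishTime N p y.length)))))) ?_⟩
  · simp [← hy₂, ← hk]
  · simp
    omega
  · simp only [hs₃, Function.update_apply]
    split_ifs <;> simp_all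
  · obtain ⟨h₁, h₂⟩ := length_of_path_guessList hl
    have := sem_finish (E := E) (n := y.length)
      (s := update (update s₃ (aux 1) []) (aux 4) (encList l)) (l := l) hN y.head?
      (by simp [hs₃]; omega) (by simp [hs₃]) (by simp) (by simp [hs₃]) (by simp [hs₃])
      (by simp [hs₃]) (fun w hw => (h₂ (by simp) w hw).trans (by omega))
      (by simp at h₁; omega)
    refine Sem.congr this le_rfl ?_
    simp [hs₃]
  · unfold censusTime
    omega

/-- The machine that runs the census. -/
noncomputable def censusTM (N V : OracleTM) : OracleTM :=
  (census N V).toTM (aux 0) (aux 0)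

/-- `sem_census` holds in every environment, since the fragment contains no query instruction; the
choice of query stack and permitted set is arbitrary. -/
lemma polyTime_censusTM (hN : N.TimeBound p) (hV : V.TimeBound q) : (censusTM N V).PolyTime := by
  obtain ⟨P, hP⟩ := exists_polynomial_censusTime N V p q
  refine polyTime_toTM P fun A x => ?_
  obtain ⟨σ, h⟩ := sem_census (E := ⟨aux 0, A, Set.univ⟩) hN hV x
  rw [hP]
  exact ⟨_, _, h⟩

lemma acceptingPath_censusTM_iff (hN : N.TimeBound p) (hV : V.TimeBound q) (y : Word)
    (g : List Bool) : (censusTM N V).AcceptingPath ∅ y g ↔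
      ((guessList (V.run q ∅) (unaryVal (unaryRest y.tail)) (unaryVal y.tail) []).bind
        (finishTree N p y.head? (unaryRest (unaryRest y.tail)))).Path g true := by
  obtain ⟨σ, h⟩ := sem_census (E := ⟨aux 0, ∅, Set.univ⟩) hN hV y
  refine (h.acceptingPath_iff g).trans ?_
  simp only [Tr.path_bind, Tr.path_map, Prod.mk.injEq]
  constructor
  · rintro ⟨s', g₁, g₂, l, rfl, h₁, b, h₂, rfl, rfl⟩
    exact ⟨g₁, g₂, l, rfl, h₁, h₂⟩
  · rintro ⟨g₁, g₂, l, rfl, h₁, h₂⟩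
    exact ⟨_, g₁, g₂, l, rfl, h₁, true, h₂, rfl, rfl⟩

end Frag

/-! ### Computing polynomial bounds in unary -/

lemma exists_pow_bound (p : Polynomial ℕ) : ∃ c d : ℕ, ∀ n, p.eval n ≤ c * (n + 1) ^ d := by
  induction p using Polynomial.induction_on' with
  | add p q hp hq =>
    obtain ⟨c, d, h⟩ := hp
    obtain ⟨c', d', h'⟩ := hq
    refine ⟨c + c', d + d', fun n => ?_⟩
    have h₁ : (n + 1) ^ d ≤ (n + 1) ^ (d + d') := Nat.pow_le_pow_right (by omega) (by omega)
    have h₂ : (n + 1) ^ d' ≤ (n + 1) ^ (d + d') := Nat.pow_le_pow_right (by omega) (by omega)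
    rw [Polynomial.eval_add, add_mul]
    exact Nat.add_le_add ((h n).trans (Nat.mul_le_mul_left _ h₁))
      ((h' n).trans (Nat.mul_le_mul_left _ h₂))
  | monomial d c =>
    refine ⟨c, d, fun n => ?_⟩
    rw [Polynomial.eval_monomial]
    gcongr
    omega

/-- The word that asks the census machine about `k` words of length at most `m` and about `x`. -/
def censusCode (b : Bool) (k m : ℕ) (x : Word) : Word :=
  b :: (List.replicate k true ++ false :: (List.replicate m true ++ false :: x))

namespace Frag

section power

variable {K : Type} [DecidableEq K] {E : Env K} {s : Store K}

/-- Multiply the length of `acc` by one plus the length of `src`. -/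
def mulSucc (src acc acc' tmp : K) : Frag K Unit :=
  (iter (fun _ : Unit => (pop acc id).bind fun
    | none => pure acc (.inr ())
    | some _ => (push acc' true ()).bind fun _ =>
      copy src tmp acc' (fun _ => true) (.inl ())) ()).bind fun _ => move acc' acc ()

lemma sem_mulSucc {src acc acc' tmp : K} (h : [src, acc, acc', tmp].Nodup) {a n : ℕ}
    (hn : (s src).length = n) (ha : s acc = List.replicate a true) (h' : s acc' = [])
    (ht : s tmp = []) :
    Sem E (mulSucc src acc acc' tmp) s (a * (7 * n + 6) + 4)
      (.ret ((), update s acc (List.replicate (a * (n + 1)) true))) := by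
  simp at h
  obtain ⟨⟨h₁, h₂, h₃⟩, ⟨h₄, h₅⟩, h₆⟩ := h
  have g₁ := Ne.symm h₁
  have g₂ := Ne.symm h₂
  have g₃ := Ne.symm h₃
  have g₄ := Ne.symm h₄
  have g₅ := Ne.symm h₅
  have g₆ := Ne.symm h₆
  have hloop (a : ℕ) : ∀ s : Store K, (s src).length = n → s tmp = [] →
      s acc = List.replicate a true → Sem E
      (iter (fun _ : Unit => (pop acc id).bind fun
        | none => pure acc (.inr ())
        | some _ => (push acc' true ()).bind fun _ =>
          copy src tmp acc' (fun _ => true) (.inl ())) ()) s (a * (5 * n + 4) + 3)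
      (.ret ((), update (update s acc []) acc'
        (List.replicate (a * (n + 1)) true ++ s acc'))) := by
    induction a with
    | zero =>
      intro s hn ht ha
      refine Sem.mono (T := 1 + 2) (Sem.iter_inr (Sem.bind_ret (a := none) (Sem.to (sem_pop acc id)
        le_rfl (by simp [ha]) fun _ => rfl) (Sem.to (sem_pure acc _) le_rfl rfl fun k => ?_)))
        (by omega)
      simp only [Function.update_apply]
      split_ifs <;> simp_all
    | succ a ih =>
      intro s hn ht ha
      set s' := update (update s acc (List.replicate a true)) acc'
        (List.replicate (n + 1) true ++ s acc') with hs'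
      refine Sem.mono (Sem.iter_inl (s' := s') (T := 1 + (1 + (5 * n + 2)))
        (Sem.bind_ret (Sem.to (sem_pop acc id) le_rfl (a' := some true)
          (by simp [ha, List.replicate_succ]) fun _ => rfl) (Sem.bind_ret (sem_push acc' true ())
          (Sem.to (sem_copy h₃ h₂ g₆ _ _ ?_) ?_ rfl fun k => ?_)))
        (Sem.to (ih s' ?_ ?_ ?_) le_rfl rfl fun k => ?_)) (by linarith)
      · simp [g₅, g₆, ht]
      · simp [h₁, h₂, hn]
      · have : (s src).map (fun _ => true) = List.replicate n true := by simp [hn]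
        simp only [hs', Function.update_apply, List.replicate_succ', List.append_assoc]
        split_ifs <;> simp_all
      · simp [hs', h₁, h₂, hn]
      · simp [hs', g₅, g₆, ht]
      · simp [hs', h₄]
      · have : List.replicate ((a + 1) * (n + 1)) true =
            List.replicate (a * (n + 1)) true ++ List.replicate (n + 1) true := by
          rw [← List.replicate_add]
          congr 1
          ring
        simp only [hs', Function.update_apply, this, List.append_assoc]
        split_ifs <;> simp_all
  refine Sem.mono (Sem.bind_ret (hloop a s hn ht ha) (Sem.to (sem_move g₄ ()) le_rfl rfl
    fun k => ?_)) ?_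
  · simp only [Function.update_apply]
    split_ifs <;> simp_all
  · simp [h']
    linarith

/-- Put `n` symbols on the stack `k`. -/
def pushMany (k : K) : ℕ → Frag K Unit
  | 0 => pure k ()
  | n + 1 => (push k true ()).bind fun _ => pushMany k n

lemma sem_pushMany (k : K) (n : ℕ) :
    Sem E (pushMany k n) s (n + 2) (.ret ((), update s k (List.replicate n true ++ s k))) := by
  induction n generalizing s with
  | zero => exact Sem.to (sem_pure k ()) le_rfl rfl (by simp)
  | succ n ih =>
    refine Sem.mono (Sem.bind_ret (sem_push k true ()) (Sem.to ih le_rfl rfl fun j => ?_))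
      (by omega)
    simp [List.replicate_succ']

/-- Compute `c * (n + 1) ^ d` in unary, where `n` is the length of `src`. -/
def power (src acc acc' tmp : K) (c : ℕ) : ℕ → Frag K Unit
  | 0 => pushMany acc c
  | d + 1 => (power src acc acc' tmp c d).bind fun _ => mulSucc src acc acc' tmp

def powerTime (c : ℕ) : ℕ → ℕ → ℕ
  | 0, _ => c + 2
  | d + 1, n => powerTime c d n + (c * (n + 1) ^ d * (7 * n + 6) + 4)

lemma exists_polynomial_powerTime (c d : ℕ) :
    ∃ P : Polynomial ℕ, ∀ n, P.eval n = powerTime c d n := by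
  induction d with
  | zero => exact ⟨.C (c + 2), fun n => by simp [powerTime]⟩
  | succ d ih =>
    obtain ⟨P, hP⟩ := ih
    exact ⟨P + (.C c * (.X + 1) ^ d * (7 * .X + 6) + 4), fun n => by simp [powerTime, hP]⟩

lemma sem_power {src acc acc' tmp : K} (h : [src, acc, acc', tmp].Nodup) {n : ℕ} (c d : ℕ)
    (hn : (s src).length = n) (ha : s acc = []) (h' : s acc' = []) (ht : s tmp = []) :
    Sem E (power src acc acc' tmp c d) s (powerTime c d n)
      (.ret ((), update s acc (List.replicate (c * (n + 1) ^ d) true))) := by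
  induction d with
  | zero => exact Sem.to (sem_pushMany acc c) le_rfl rfl (by simp [ha])
  | succ d ih =>
    have hd := h
    simp at hd
    refine Sem.bind_ret ih (Sem.to (sem_mulSucc h (n := n) ?_ (Function.update_self ..) ?_ ?_)
      le_rfl rfl fun k => ?_)
    · rw [Function.update_of_ne (by tauto), hn]
    · rw [Function.update_of_ne (by tauto), h']
    · rw [Function.update_of_ne (by tauto), ht]
    · rw [Function.update_idem, mul_assoc, ← pow_succ]

end power

/-! ### The deterministic search for the census -/

section search

variable {E : Env (Fin 6)} {s : Store (Fin 6)}

/-- Write a question to the census machine on the stack 3, where 0 holds the input, 1 and 2 hold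
the numbers, and 4 is a scratch stack. -/
def ask (b : Bool) : Frag (Fin 6) Unit :=
  (copy 0 4 3 id ()).bind fun _ => (push 3 false ()).bind fun _ =>
    (copy 1 4 3 id ()).bind fun _ => (push 3 false ()).bind fun _ =>
      (copy 2 4 3 id ()).bind fun _ => push 3 b ()

/-- The top of the stack is the first symbol, so the code is written from its end. -/
lemma sem_ask (b : Bool) {k m n : ℕ} {x : Word} (h₀ : s 0 = x)
    (h₁ : s 1 = List.replicate m true) (h₂ : s 2 = List.replicate k true) (h₃ : s 3 = [])
    (h₄ : s 4 = []) (hn : x.length ≤ n) (hm : m ≤ n) (hk : k ≤ n) :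
    Sem E (ask b) s (15 * n + 9) (.ret ((), update s 3 (censusCode b k m x))) := by
  refine Sem.mono (T := 5 * n + 2 + (1 + (5 * n + 2 + (1 + (5 * n + 2 + 1)))))
    (Sem.bind_ret (Sem.to (sem_copy (by simp) (by simp) (by simp) _ _ h₄) ?_ rfl fun _ => rfl)
    (Sem.bind_ret (sem_push _ _ ())
    (Sem.bind_ret (Sem.to (sem_copy (by simp) (by simp) (by simp) _ _ (by simp [h₄])) ?_ rfl
      fun _ => rfl)
    (Sem.bind_ret (sem_push _ _ ())
    (Sem.bind_ret (Sem.to (sem_copy (by simp) (by simp) (by simp) _ _ (by simp [h₄])) ?_ rfl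
      fun _ => rfl)
    (Sem.to (sem_push _ _ ()) le_rfl rfl fun k => ?_)))))) (by omega)
  · rw [h₀]; omega
  · simp [h₁]; omega
  · simp [h₂]; omega
  · simp [h₀, h₁, h₂, h₃, censusCode]

/-- Ask the census machine with descending numbers, until it answers yes; then ask about the
input. -/
def search : Frag (Fin 6) Bool :=
  iter (fun _ : Unit => (ask false).bind fun _ => (query id).bind fun
    | true => (ask true).bind fun _ => query .inr
    | false => pop 2 fun o => o.elim (.inr false) fun _ => .inl ()) ()

open Classical in
/-- The result of `search`. -/
noncomputable def searchVal (A : Lang) (m : ℕ) (x : Word) : ℕ → Bool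
  | 0 => if censusCode false 0 m x ∈ A then decide (censusCode true 0 m x ∈ A) else false
  | k + 1 => if censusCode false (k + 1) m x ∈ A then decide (censusCode true (k + 1) m x ∈ A)
      else searchVal A m x k

/-- The number `j` is reached only after all larger ones were answered no, and the flagged question
is asked only after a yes. Accordingly `hp` demands the guard only under these conditions. -/
lemma sem_search {k m n : ℕ} {x : Word} (hE : E.qs = 3) (h₀ : s 0 = x)
    (h₁ : s 1 = List.replicate m true) (h₂ : s 2 = List.replicate k true) (h₃ : s 3 = [])
    (h₄ : s 4 = []) (hn : x.length ≤ n) (hm : m ≤ n) (hk : k ≤ n)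
    (hp : ∀ j ≤ k, (∀ i, j < i → i ≤ k → censusCode false i m x ∉ E.oracle) →
      censusCode false j m x ∈ E.permitted ∧
        (censusCode false j m x ∈ E.oracle → censusCode true j m x ∈ E.permitted)) :
    ∃ s', Sem E search s ((k + 1) * (30 * n + 20)) (.ret (searchVal E.oracle m x k, s')) := by
  classical
  obtain ⟨qs, A, Q⟩ := E
  obtain rfl : qs = 3 := hE
  induction k using Nat.strong_induction_on generalizing s with
  | _ k ihk =>
    have hask (b : Bool) := sem_ask (E := ⟨3, A, Q⟩) b h₀ h₁ h₂ h₃ h₄ hn hm hk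
    have hq (b : Bool) : update s 3 (censusCode b k m x) 3 = censusCode b k m x := by simp
    have hs (b : Bool) : update (update s 3 (censusCode b k m x)) 3 [] = s := by simp [← h₃]
    obtain ⟨hp₀, hp₁⟩ := hp k le_rfl fun i h h' => by omega
    have hquery {α : Type} (b : Bool) (f : Bool → α) (h : censusCode b k m x ∈ Q) :
        Sem ⟨3, A, Q⟩ (query f) (update s 3 (censusCode b k m x)) 1
          (.ret (f (decide (censusCode b k m x ∈ A)), s)) :=
      Sem.to (sem_query f (by rwa [hq])) le_rfl (by rw [hq]) fun j => by rw [hs]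
    by_cases hA : censusCode false k m x ∈ A
    · refine ⟨s, Sem.mono (Sem.iter_inr (Sem.bind_ret (hask false) (Sem.bind_ret (a := true)
        (Sem.to (hquery false id hp₀) le_rfl (by simp [hA]) fun _ => rfl) (Sem.bind_ret (hask true)
        (Sem.to (hquery true _ (hp₁ hA)) le_rfl ?_ fun _ => rfl))))) (by nlinarith)⟩
      cases k <;> simp [searchVal, hA]
    · cases k with
      | zero =>
        refine ⟨_, Sem.mono (Sem.iter_inr (Sem.bind_ret (hask false) (Sem.bind_ret (a := false)
          (Sem.to (hquery false id hp₀) le_rfl (by simp [hA]) fun _ => rfl)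
          (Sem.to (sem_pop 2 _) le_rfl ?_ fun _ => rfl)))) (by nlinarith)⟩
        simp [h₂, searchVal, hA]
      | succ k =>
        have ih := ihk k (by omega) (s := update s 2 (List.replicate k true)) (by simp [h₀]) (by simp [h₁]) (by simp) (by simp [h₃])
          (by simp [h₄]) (by omega) fun j hj hi => hp j (by omega) fun i h h' => by
            obtain rfl | h' := h'.eq_or_lt
            · exact hA
            · exact hi i h (by omega)
        obtain ⟨s', ih⟩ := ih
        refine ⟨s', Sem.mono (Sem.iter_inl (s' := update s 2 (List.replicate k true))
          (Sem.bind_ret (hask false) (Sem.bind_ret (a := false)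
          (Sem.to (hquery false id hp₀) le_rfl (by simp [hA]) fun _ => rfl)
          (Sem.to (sem_pop 2 _) le_rfl ?_ fun j => ?_))) (Sem.to ih le_rfl ?_ fun _ => rfl))
          (by nlinarith)⟩
        · simp [h₂, List.replicate_succ]
        · simp [h₂, List.replicate_succ]
        · simp [searchVal, hA]

/-- Compute the two numbers, and search. -/
def reduction (c d c' d' : ℕ) : Frag (Fin 6) Bool :=
  (power 0 1 4 5 c d).bind fun _ => (power 1 2 4 5 c' d').bind fun _ => search

/-- The polynomial comes before the environment because it serves twice: with the census oracle and
the guarded queries, and, for the running time, with an arbitrary oracle and all queries permitted.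
-/
lemma exists_polynomial_reduction (c d c' d' : ℕ) : ∃ P : Polynomial ℕ,
    ∀ (E : Env (Fin 6)) (x : Word) (m r : ℕ), m = c * (x.length + 1) ^ d →
      r = c' * (m + 1) ^ d' → E.qs = 3 →
      (∀ j ≤ r, (∀ i, j < i → i ≤ r → censusCode false i m x ∉ E.oracle) →
        censusCode false j m x ∈ E.permitted ∧
        (censusCode false j m x ∈ E.oracle → censusCode true j m x ∈ E.permitted)) →
      ∃ s', Sem E (reduction c d c' d') (update (fun _ => []) 0 x) (P.eval x.length)
        (.ret (searchVal E.oracle m x r, s')) := by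
  obtain ⟨P₁, hP₁⟩ := exists_polynomial_powerTime c d
  obtain ⟨P₂, hP₂⟩ := exists_polynomial_powerTime c' d'
  let pm : Polynomial ℕ := .C c * (.X + 1) ^ d
  let pr : Polynomial ℕ := .C c' * (pm + 1) ^ d'
  refine ⟨P₁ + (P₂.comp pm + (pr + 1) * (30 * (.X + pm + pr) + 20)), ?_⟩
  intro E x m r hm hr hE hp
  have hm' : pm.eval x.length = m := by simp [pm, hm]
  have hr' : pr.eval x.length = r := by simp [pr, hr, hm']
  obtain ⟨s', hs⟩ := sem_search (E := E) (n := x.length + m + r) (s := update (update (update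
    (fun _ => []) 0 x) 1 (List.replicate m true)) 2 (List.replicate r true)) (x := x) (m := m)
    (k := r) hE (by simp) (by simp) (by simp) (by simp) (by simp) (by omega) (by omega)
    (by omega) hp
  refine ⟨s', Sem.mono (Sem.bind_ret (Sem.to (s'' := update (update (fun _ => []) 0 x) 1
    (List.replicate m true)) (sem_power (by simp) c d rfl (by simp) (by simp) (by simp)) le_rfl rfl
    ?_) (Sem.bind_ret (Sem.to (sem_power (by simp) c' d' rfl (by simp) (by simp) (by simp)) le_rfl
    rfl ?_) hs)) ?_⟩
  · simp [hm]
  · simp [hr]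
  · simp [hP₁, hP₂, Polynomial.eval_comp, hm', hr']

end search

end Frag

/-! ### Counting the guessed lists -/

section guessList

variable {R : Word → Tr Bool} {m n : ℕ} {l l' l'' : List Word} {g : List Bool}

lemma OkNext.pairwise {c : Word} (h : OkNext l c) (hl : l.Pairwise (· > ·)) :
    (c :: l).Pairwise (· > ·) := by
  cases l with
  | nil => simp
  | cons e l =>
    refine List.pairwise_cons.2 ⟨fun w hw => ?_, hl⟩
    rcases List.mem_cons.1 hw with rfl | hw
    · exact h
    · exact lt_trans ((List.pairwise_cons.1 hl).1 w hw) h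

lemma path_guessList_succ {l₀ : List Word} : (guessList R m (n + 1) l).Path g l₀ ↔
    ∃ c g₁ g₂ g₃, g = g₁ ++ (g₂ ++ g₃) ∧ (guessTree m []).Path g₁ c ∧ OkNext l c ∧
      (R c).Path g₂ true ∧ (guessList R m n (c :: l)).Path g₃ l₀ := by
  classical
  simp only [guessList, Tr.path_bind]
  constructor
  · rintro ⟨g₁, g', c, rfl, h₁, h⟩
    split_ifs at h with hc
    · obtain ⟨g₂, g₃, b, rfl, h₂, h₃⟩ := Tr.path_bind.1 h
      cases b
      · exact h₃.elim
      · exact ⟨c, g₁, g₂, g₃, rfl, h₁, hc, h₂, h₃⟩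
    · exact h.elim
  · rintro ⟨c, g₁, g₂, g₃, rfl, h₁, hc, h₂, h₃⟩
    refine ⟨g₁, g₂ ++ g₃, c, rfl, h₁, ?_⟩
    rw [if_pos hc]
    exact Tr.path_bind.2 ⟨g₂, g₃, true, rfl, h₂, h₃⟩

lemma path_guessTree_length {c : Word} (h : (guessTree m []).Path g c) : c.length ≤ m := by
  obtain ⟨u, rfl, hu⟩ := exists_path_guessTree_iff.1 ⟨g, h⟩
  simpa using hu

lemma exists_append_of_path (h : (guessList R m n l).Path g l') :
    ∃ u, l' = u ++ l ∧ u.length = n ∧ (l.Pairwise (· > ·) → l'.Pairwise (· > ·)) ∧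
      ∀ w ∈ u, w.length ≤ m ∧ ∃ g, (R w).Path g true := by
  induction n generalizing l g with
  | zero =>
    obtain ⟨-, rfl⟩ := h
    exact ⟨[], by simp⟩
  | succ n ih =>
    obtain ⟨c, g₁, g₂, g₃, rfl, h₁, hc, h₂, h₃⟩ := path_guessList_succ.1 h
    obtain ⟨u, rfl, hu, hp, hR⟩ := ih h₃
    refine ⟨u ++ [c], by simp, by simp [hu], fun hl => hp (hc.pairwise hl), fun w hw => ?_⟩
    rcases List.mem_append.1 hw with hw | hw
    · exact hR w hw
    · obtain rfl := List.mem_singleton.1 hw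
      exact ⟨path_guessTree_length h₁, g₂, h₂⟩

lemma exists_path_guessList {u : List Word} (hp : (u ++ l).Pairwise (· > ·))
    (hR : ∀ w ∈ u, w.length ≤ m ∧ ∃ g, (R w).Path g true) :
    ∃ g, (guessList R m u.length l).Path g (u ++ l) := by
  induction hn : u.length generalizing u l with
  | zero =>
    obtain rfl := List.length_eq_zero_iff.1 hn
    exact ⟨[], rfl, rfl⟩
  | succ n ih =>
    -- Words are put in front, so the last word of `u` is the one guessed first.
    obtain rfl | ⟨u, c, rfl⟩ := u.eq_nil_or_concat'
    · simp at hn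
    · obtain ⟨hc, g₂, h₂⟩ := hR c (by simp)
      obtain ⟨g₁, h₁⟩ := (exists_path_guessTree_iff (n := m) (w := [])).2 ⟨c, (List.append_nil c).symm, hc⟩
      rw [List.append_assoc] at hp
      obtain ⟨g₃, h₃⟩ := ih (u := u) (l := c :: l) hp (fun w hw => hR w (by simp [hw]))
        (by simpa using hn)
      refine ⟨_, path_guessList_succ.2 ⟨c, g₁, g₂, g₃, rfl, h₁, ?_, h₂, by simpa using h₃⟩⟩
      have := (List.pairwise_append.1 hp).2.1
      cases l with
      | nil => trivial
      | cons e l => exact (List.pairwise_cons.1 this).1 e (by simp)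

/-- The final list reveals the word guessed in every round; the path to a given word is unique, and
so is the path on which `R` accepts it. -/
lemma inj_guessList (hR : ∀ c g g', (R c).Path g true → (R c).Path g' true → g = g') :
    (guessList R m n l).Inj := by
  induction n generalizing l with
  | zero =>
    rintro g g' v ⟨rfl, -⟩ ⟨rfl, -⟩
    rfl
  | succ n ih =>
    intro g g' l₀ h h'
    obtain ⟨c, g₁, g₂, g₃, rfl, h₁, hc, h₂, h₃⟩ := path_guessList_succ.1 h
    obtain ⟨c', g₁', g₂', g₃', rfl, h₁', hc', h₂', h₃'⟩ := path_guessList_succ.1 h'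
    obtain ⟨u, hu, hun, -⟩ := exists_append_of_path h₃
    obtain ⟨u', hu', hun', -⟩ := exists_append_of_path h₃'
    -- Exactly `n` words are added in the remaining rounds, so the two final lists split at the same
    -- place.
    have := (List.append_inj (hu.symm.trans hu') (hun.trans hun'.symm)).2
    obtain rfl : c = c' := by simpa using this
    rw [inj_guessTree _ _ _ _ _ h₁ h₁', hR _ _ _ h₂ h₂', ih _ _ _ h₃ h₃']

/-- The words that can occur in the lists. -/
def goodWords (R : Word → Tr Bool) (m : ℕ) : Set Word :=
  {w | (∃ g, (R w).Path g true) ∧ w.length ≤ m}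

lemma finite_goodWords (R : Word → Tr Bool) (m : ℕ) : (goodWords R m).Finite :=
  (List.finite_length_le Bool m).subset fun _ h => h.2

lemma path_guessList_nil (h : (guessList R m n []).Path g l) :
    l.Pairwise (· > ·) ∧ l.length = n ∧ {w | w ∈ l} ⊆ goodWords R m := by
  obtain ⟨u, rfl, hn, hp, hR⟩ := exists_append_of_path h
  rw [List.append_nil] at *
  exact ⟨hp .nil, hn, fun w hw => ⟨(hR w hw).2, (hR w hw).1⟩⟩

lemma ncard_setOf_mem (h : l.Pairwise (· > ·)) : {w | w ∈ l}.ncard = l.length := by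
  have hn : l.Nodup := h.imp fun h => ne_of_gt h
  rw [← List.toFinset_card_of_nodup hn, ← Set.ncard_coe_finset]
  congr 1
  ext w
  simp

/-- The words of a strictly decreasing list are distinct, and all of them are good. -/
lemma le_ncard_of_path (h : (guessList R m n []).Path g l) : n ≤ (goodWords R m).ncard := by
  obtain ⟨hp, rfl, hs⟩ := path_guessList_nil h
  rw [← ncard_setOf_mem hp]
  exact Set.ncard_le_ncard hs (finite_goodWords R m)

/-- The heart of the census argument: distinct good words, as many as there are, must be all of
them. -/
lemma setOf_mem_eq_of_path (h : (guessList R m (goodWords R m).ncard []).Path g l) :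
    {w | w ∈ l} = goodWords R m := by
  obtain ⟨hp, hn, hs⟩ := path_guessList_nil h
  exact Set.eq_of_subset_of_ncard_le hs (by rw [ncard_setOf_mem hp, hn]) (finite_goodWords R m)

/-- Fixing the order is essential here: a set has only one strictly decreasing enumeration, and
without it every permutation would give a further path. -/
lemma eq_of_path {g' : List Bool} (h : (guessList R m (goodWords R m).ncard []).Path g l)
    (h' : (guessList R m (goodWords R m).ncard []).Path g' l') : l = l' := by
  have hs := (setOf_mem_eq_of_path h).trans (setOf_mem_eq_of_path h').symm
  have hp := (path_guessList_nil h).1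
  have hp' := (path_guessList_nil h').1
  refine List.Perm.eq_of_pairwise' hp hp' ?_
  rw [List.perm_ext_iff_of_nodup (hp.imp fun h => ne_of_gt h) (hp'.imp fun h => ne_of_gt h)]
  exact fun w => Set.ext_iff.1 hs w

lemma exists_path_ncard : ∃ g l, (guessList R m (goodWords R m).ncard []).Path g l := by
  set W := (finite_goodWords R m).toFinset with hW
  -- Guessing in increasing order and adding in front leaves a decreasing list.
  have hl : (W.sort (· ≥ ·)).Pairwise (· > ·) := W.sortedGT_sort.pairwise
  obtain ⟨g, hg⟩ := exists_path_guessList (R := R) (m := m) (u := W.sort (· ≥ ·)) (l := [])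
    (by simpa using hl) fun w hw => by
      have : w ∈ goodWords R m := by simpa [hW] using hw
      exact ⟨this.2, this.1⟩
  rw [Finset.length_sort, ← Set.ncard_eq_toFinset_card _ (finite_goodWords R m)] at hg
  exact ⟨g, _, hg⟩

end guessList

/-! ### Determinism of the search -/

namespace Frag

section deterministic

variable {K α β σ : Type}

/-- The fragment never branches nondeterministically. -/
def Det (F : Frag K α) : Prop := ∀ l nx, F.instr l ≠ .guess nx

lemma map_ne_guess {Λ Λ' : Type} {i : Instr K Λ} (hi : ∀ nx, i ≠ .guess nx) (f : Λ → Λ') (nx) :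
    i.map f ≠ .guess nx := by
  cases i <;> simp_all [Instr.map]

lemma det_push (k : K) (b : Bool) (a : α) : (push k b a).Det := nofun

lemma det_pop (k : K) (f : Option Bool → α) : (pop k f).Det := nofun

lemma det_query (f : Bool → α) : (query f : Frag K α).Det := nofun

lemma Det.bind [Finite α] {F : Frag K α} {G : α → Frag K β} (hF : F.Det) (hG : ∀ a, (G a).Det) :
    (F.bind G).Det
  | .inl l => map_ne_guess (hF l) _
  | .inr l => map_ne_guess (hG l.1 l.2) _

lemma Det.iter [Finite σ] {F : σ → Frag K (σ ⊕ α)} (hF : ∀ x, (F x).Det) (x : σ) :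
    (iter F x).Det := fun l => map_ne_guess (hF l.1 l.2) _

lemma det_pure (k : K) (a : α) : (pure k a).Det := (det_push _ _ _).bind fun _ => det_pop _ _

lemma det_move (src dst : K) (a : α) : (move src dst a).Det :=
  .iter (fun | none => det_pop _ _ | some _ => det_push _ _ _) _

lemma det_moveTwo (src d₁ d₂ : K) (f : Bool → Bool) (a : α) : (moveTwo src d₁ d₂ f a).Det :=
  .iter (fun | none => det_pop _ _ | some _ => (det_push _ _ _).bind fun _ => det_push _ _ _) _

lemma det_copy (src tmp dst : K) (f : Bool → Bool) (a : α) : (copy src tmp dst f a).Det :=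
  (det_move _ _ _).bind fun _ => det_moveTwo _ _ _ _ _

lemma det_mulSucc (src acc acc' tmp : K) : (mulSucc src acc acc' tmp).Det :=
  Det.bind (.iter (fun _ => (det_pop _ _).bind fun
    | none => det_pure _ _
    | some _ => (det_push _ _ _).bind fun _ => det_copy _ _ _ _ _) _) fun _ => det_move _ _ _

lemma det_pushMany (k : K) (n : ℕ) : (pushMany k n).Det := by
  induction n with
  | zero => exact det_pure _ _
  | succ n ih => exact (det_push _ _ _).bind fun _ => ih

lemma det_power (src acc acc' tmp : K) (c d : ℕ) : (power src acc acc' tmp c d).Det := by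
  induction d with
  | zero => exact det_pushMany _ _
  | succ n ih => exact ih.bind fun _ => det_mulSucc _ _ _ _

lemma det_ask (b : Bool) : (ask b).Det :=
  (det_copy _ _ _ _ _).bind fun _ => (det_push _ _ _).bind fun _ => (det_copy _ _ _ _ _).bind
    fun _ => (det_push _ _ _).bind fun _ => (det_copy _ _ _ _ _).bind fun _ => det_push _ _ _

lemma det_search : search.Det :=
  .iter (fun _ => (det_ask _).bind fun _ => (det_query _).bind fun
    | true => (det_ask _).bind fun _ => det_query _
    | false => det_pop _ _) _

lemma det_reduction (c d c' d' : ℕ) : (reduction c d c' d').Det :=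
  (det_power _ _ _ _ _ _).bind fun _ => (det_power _ _ _ _ _ _).bind fun _ => det_search

lemma Det.toTM [DecidableEq K] [Finite K] {F : Frag K Bool} (hF : F.Det) (inp qs : K) :
    (F.toTM inp qs).Deterministic
  | .inl l => hF l
  | .inr true => nofun
  | .inr false => nofun

end deterministic

/-! ### Correctness and unambiguity at the true census -/

section correctness

variable {N V : OracleTM} {p q : Polynomial ℕ}

lemma acceptingPath_censusCode_iff (hN : N.TimeBound p) (hV : V.TimeBound q) (b : Bool) (k m : ℕ)
    (x : Word) (g : List Bool) : (censusTM N V).AcceptingPath ∅ (censusCode b k m x) g ↔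
      ((guessList (V.run q ∅) m k []).bind (finishTree N p (some b) x)).Path g true := by
  rw [acceptingPath_censusTM_iff hN hV]
  simp [censusCode]

lemma goodWords_run (hV : V.TimeBound q) (m : ℕ) :
    goodWords (V.run q ∅) m = {w | w ∈ V.lang ∅ ∧ w.length ≤ m} := by
  ext w
  simp [goodWords, hV.path_run_iff, OracleTM.lang]

/-- By `hm`, `N` with its true oracle asks only words of length at most `m`, and on these the list
answers correctly. -/
lemma run_setOf_mem (hN : N.TimeBound p) (hV : V.TimeBound q) {m : ℕ} {x : Word}
    (hm : x.length + p.eval x.length ≤ m) {l : List Word}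
    (hl : {w | w ∈ l} = goodWords (V.run q ∅) m) :
    N.run p {w | w ∈ l} x = N.run p (V.lang ∅) x := by
  -- The equation is reversed so that the queries to be controlled are those of the run with the
  -- true oracle.
  refine (OracleTM.run_congr fun y hy => ?_).symm
  have := (hN.length_query_le hy).trans hm
  rw [hl, goodWords_run hV]
  simp [this]

/-- There are too few good words to complete a list. Such questions are therefore trivially
unambiguous, which makes the downward search safe. -/
lemma not_acceptingPath_censusCode_of_lt (hN : N.TimeBound p) (hV : V.TimeBound q) {b : Bool}
    {k m : ℕ} {x : Word} (hk : (goodWords (V.run q ∅) m).ncard < k) (g : List Bool) :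
    ¬ (censusTM N V).AcceptingPath ∅ (censusCode b k m x) g := by
  rw [acceptingPath_censusCode_iff hN hV, Tr.path_bind]
  rintro ⟨g₁, g₂, l, -, h, -⟩
  exact (le_ncard_of_path h).not_gt hk

/-- An accepting path splits into a path to the list and a path of the last phase. The list is
unique and so is the path to it; the last phase is a single leaf or the run of `N` with its true
answers. -/
lemma unambiguousAt_censusCode (hN : N.TimeBound p) (hV : V.TimeBound q)
    (hVu : ∀ w, V.UnambiguousAt ∅ w) {m : ℕ} {x : Word}
    (hNu : N.UnambiguousAt (V.lang ∅) x) (hm : x.length + p.eval x.length ≤ m) (b : Bool) :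
    (censusTM N V).UnambiguousAt ∅ (censusCode b (goodWords (V.run q ∅) m).ncard m x) := by
  intro g g' h h'
  rw [acceptingPath_censusCode_iff hN hV, Tr.path_bind] at h h'
  obtain ⟨g₁, g₂, l, rfl, h₁, h₂⟩ := h
  obtain ⟨g₁', g₂', l', rfl, h₁', h₂'⟩ := h'
  obtain rfl := eq_of_path h₁ h₁'
  have hinj : (guessList (V.run q ∅) m (goodWords (V.run q ∅) m).ncard []).Inj :=
    inj_guessList fun c g g' hg hg' => hVu c g g' (hV.path_run_iff.1 hg) (hV.path_run_iff.1 hg')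
  rw [hinj _ _ _ h₁ h₁']
  congr 1
  cases b
  · simp [finishTree] at h₂ h₂'
    rw [h₂, h₂']
  · simp only [finishTree, if_true, run_setOf_mem hN hV hm (setOf_mem_eq_of_path h₁),
      hN.path_run_iff] at h₂ h₂'
    exact hNu _ _ h₂ h₂'

lemma censusCode_false_mem (hN : N.TimeBound p) (hV : V.TimeBound q) (m : ℕ) (x : Word) :
    censusCode false (goodWords (V.run q ∅) m).ncard m x ∈ (censusTM N V).lang ∅ := by
  obtain ⟨g, l, h⟩ := exists_path_ncard (R := V.run q ∅) (m := m)
  exact ⟨g ++ [], (acceptingPath_censusCode_iff hN hV _ _ _ _ _).2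
    (Tr.path_bind.2 ⟨g, [], l, rfl, h, by simp [finishTree]⟩)⟩

lemma censusCode_true_mem_iff (hN : N.TimeBound p) (hV : V.TimeBound q) {m : ℕ} {x : Word}
    (hm : x.length + p.eval x.length ≤ m) :
    censusCode true (goodWords (V.run q ∅) m).ncard m x ∈ (censusTM N V).lang ∅ ↔
      x ∈ N.lang (V.lang ∅) := by
  constructor
  · rintro ⟨g, hg⟩
    rw [acceptingPath_censusCode_iff hN hV, Tr.path_bind] at hg
    obtain ⟨g₁, g₂, l, rfl, h₁, h₂⟩ := hg
    simp only [finishTree, if_true, run_setOf_mem hN hV hm (setOf_mem_eq_of_path h₁),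
      hN.path_run_iff] at h₂
    exact ⟨g₂, h₂⟩
  · rintro ⟨g₂, h₂⟩
    obtain ⟨g, l, h⟩ := exists_path_ncard (R := V.run q ∅) (m := m)
    refine ⟨g ++ g₂, (acceptingPath_censusCode_iff hN hV _ _ _ _ _).2
      (Tr.path_bind.2 ⟨g, g₂, l, rfl, h, ?_⟩)⟩
    simpa only [finishTree, if_true, run_setOf_mem hN hV hm (setOf_mem_eq_of_path h),
      hN.path_run_iff] using h₂

open Classical in
lemma searchVal_eq {A : Lang} {m k₀ k : ℕ} {x : Word} (h₀ : censusCode false k₀ m x ∈ A)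
    (h : ∀ j, k₀ < j → censusCode false j m x ∉ A) (hk : k₀ ≤ k) :
    searchVal A m x k = decide (censusCode true k₀ m x ∈ A) := by
  induction k with
  | zero =>
    obtain rfl : k₀ = 0 := by omega
    simp [searchVal, h₀]
  | succ k ih =>
    obtain rfl | hk := hk.eq_or_lt
    · simp [searchVal, h₀]
    · rw [searchVal, if_neg (h _ hk), ih (by omega)]

end correctness

end Frag

/-! ### The main theorem -/

open Frag

/-- With a sparse oracle in `UP`, guarded access to a language in `NP` suffices. -/
theorem UPRel_subset_PPromiseUP {S : Lang} (hS : IsSparse S) (hU : S ∈ UP) :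
    UPRel S ⊆ PPromiseUP := by
  classical
  rintro L ⟨N, ⟨p, hN⟩, hNu, rfl⟩
  obtain ⟨V, ⟨q, hV⟩, hVu, rfl⟩ := hU
  obtain ⟨r, hr⟩ := hS
  -- The deterministic machine must compute its bounds itself, so both get the form c(n + 1)^d: `c`,
  -- `d` bound the length of the queries of `N`, and `c'`, `d'` the number of words up to that
  -- length.
  obtain ⟨c, d, hm⟩ := exists_pow_bound (.X + p)
  obtain ⟨c', d', hcard⟩ := exists_pow_bound r
  obtain ⟨P, hP⟩ := exists_polynomial_reduction c d c' d'
  change N.TimeBound p at hN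
  change V.TimeBound q at hV
  set O := (censusTM N V).lang ∅ with hO
  have key (x : Word) : ∃ s', Sem ⟨3, O, {y | (censusTM N V).UnambiguousAt ∅ y}⟩
      (reduction c d c' d') (update (fun _ => []) 0 x) (P.eval x.length)
      (.ret (decide (x ∈ N.lang (V.lang ∅)), s')) := by
    set m := c * (x.length + 1) ^ d with hmd
    set k₀ := (goodWords (V.run q ∅) m).ncard with hk₀
    have hxm : x.length + p.eval x.length ≤ m := by simpa using hm x.length
    have hk : k₀ ≤ c' * (m + 1) ^ d' := by
      rw [hk₀, goodWords_run hV]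
      exact (hr m).trans (hcard m)
    have hlt (j : ℕ) (h : k₀ < j) (b : Bool) (g : List Bool) :
        ¬ (censusTM N V).AcceptingPath ∅ (censusCode b j m x) g :=
      not_acceptingPath_censusCode_of_lt hN hV h g
    have h₀ : censusCode false k₀ m x ∈ O := censusCode_false_mem hN hV m x
    have h₁ (j : ℕ) (h : k₀ < j) : censusCode false j m x ∉ O := fun ⟨g, hg⟩ => hlt j h _ g hg
    have hu (b : Bool) := unambiguousAt_censusCode hN hV hVu (hNu x) hxm b
    obtain ⟨s', hs⟩ := hP ⟨3, O, {y | (censusTM N V).UnambiguousAt ∅ y}⟩ x m _ hmd rfl rfl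
      fun j hj hi => by
        -- Below `k₀` the search would already have seen the yes at `k₀`; at `k₀` the census is
        -- unambiguous; above it no path accepts, so the guard is vacuous and the flagged question
        -- does not follow.
        rcases lt_trichotomy j k₀ with h | rfl | h
        · exact absurd h₀ (hi k₀ h hk)
        · exact ⟨hu false, fun _ => hu true⟩
        · exact ⟨fun g _ hg => absurd hg (hlt j h _ g), fun h' => absurd h' (h₁ j h)⟩
    refine ⟨s', ?_⟩
    rwa [searchVal_eq h₀ h₁ hk, decide_eq_decide.2 (censusCode_true_mem_iff hN hV hxm)] at hs
  refine ⟨(reduction c d c' d').toTM 0 3, censusTM N V, ?_, (det_reduction _ _ _ _).toTM _ _,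
    polyTime_censusTM hN hV, ?_, fun x y hy => ?_⟩
  · refine polyTime_toTM P fun A x => ?_
    -- With an arbitrary oracle the search may ask anything; only its running time matters here.
    obtain ⟨s', hs⟩ := hP ⟨3, A, Set.univ⟩ x _ _ rfl rfl rfl fun j _ _ => ⟨trivial, fun _ => trivial⟩
    exact ⟨_, _, hs⟩
  · ext x
    obtain ⟨s', hs⟩ := key x
    constructor
    · intro hx
      exact ⟨[], (hs.acceptingPath_iff []).2 ⟨s', rfl, by rw [decide_eq_true hx]⟩⟩
    · rintro ⟨g, hg⟩
      obtain ⟨s'', -, h⟩ := (hs.acceptingPath_iff g).1 hg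
      exact of_decide_eq_true (congrArg Prod.fst h).symm
  · obtain ⟨s', hs⟩ := key x
    exact hs.queries_subset hy

/-- Completeness provides a deterministic machine that answers the queries to `B` with the help of
`S`; composing with it preserves the number of accepting paths. -/
lemma UPRelClass_UP_subset {S : Lang} (h : IsTuringComplete S UP) : UPRelClass UP ⊆ UPRel S := by
  rintro L ⟨B, hB, N, ⟨p, hN⟩, hu, rfl⟩
  obtain ⟨M, ⟨q, hM⟩, hd, rfl⟩ := h.2 B hB
  exact ⟨N.comp M, OracleTM.polyTime_comp hN hM hd,
    fun x => (OracleTM.unambiguousAt_comp_iff hN hM hd _ x).2 (hu x),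
    (OracleTM.lang_comp hN hM hd _).symm⟩

end Cplx

theorem theorem4p3
    (h : ∃ S : Cplx.Lang, Cplx.IsSparse S ∧ Cplx.IsTuringComplete S Cplx.UP) :
    Cplx.UPRelClass Cplx.UP ⊆ Cplx.PPromiseUP ∧
      ∀ k : ℕ, 3 ≤ k → Cplx.USigma k ⊆ Cplx.PromiseUSigma (k - 1) := by
  obtain ⟨S, hS, hc⟩ := h
  have h₁ := (Cplx.UPRelClass_UP_subset hc).trans (Cplx.UPRel_subset_PPromiseUP hS hc.1)
  refine ⟨h₁, fun k hk => ?_⟩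
  obtain ⟨k, rfl⟩ := Nat.exists_eq_add_of_le' hk
  exact Cplx.USigma_subset_of_UPRelClass_UP_subset h₁ k
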